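/- **Theorem (fractional Sobolev inequality with a partial weight).** Let $n,m\ge 0$ be integers and write the points of $\mathbb{R}^{n+m}$ as $(x,\hat x)$ with $x\in\mathbb{R}^n$, $\hat x\in\mathbb{R}^m$. Let $1<p\le q<\infty$, let $p'=\frac{p}{p-1}$, and let $\alpha,\beta\in\mathbb{R}$ satisfy $$\alpha+\beta\ge 0,\qquad \alpha<\frac{m}{p'},\qquad \beta<\frac{m}{q}.$$ For real-valued $\varphi\in C_c^\infty(\mathbb{R}^{n+m})$ and $\gamma>0$ let $(-\Delta)^{\gamma/2}\varphi$ be the function whose Fourier transform is $(2\pi|\xi|)^\gamma\hat\varphi(\xi)$, where $\hat\varphi(\xi)=\int\varphi(y)e^{-2\pi i\langle y,\xi\rangle}\,dy$. Let $W_\alpha^{\gamma,p}(\mathbb{R}^{n+m})$ and $W_\alpha^{1,p}(\mathbb{R}^{n+m})$ denote the completions of $C_c^\infty(\mathbb{R}^{n+m})$ for the norms $\||\hat x|^\alpha(-\Delta)^{\gamma/2}\varphi\|_{L^p(\mathbb{R}^{n+m})}$ and $\||\hat x|^\alpha\nabla\varphi\|_{L^p(\mathbb{R}^{n+m})}$ respectively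 (the second one by convention for the gradient norm), realized as function spaces: for $D=(-\Delta)^{\gamma/2}$ or $D=\nabla$, a function $u$ belongs to the space, with $Du=f$ ($f$ measurable), if there are $\varphi_k\in C_c^\infty(\mathbb{R}^{n+m})$ with $\varphi_k\to u$ almost everywhere and $\||\hat x|^\alpha(D\varphi_k-f)\|_{L^p(\mathbb{R}^{n+m})}\to0$. (i) Let $0<\gamma<n+m$ and $$\frac1q=\frac1p+\frac{\alpha+\beta-\gamma}{n+m}.$$ Then there is a constant $S=S(n,m,p,\alpha,\beta,\gamma)>0$ such that $$\||\hat x|^{-\beta}u\|_{L^q(\mathbb{R}^{n+m})}\le S\,\||\hat x|^{\alpha}(-\Delta)^{\gamma/2}u\|_{L^p(\mathbb{R}^{n+m})}\qquad\text{for all }u\in W_\alpha^{\gamma,p}(\mathbb{R}^{n+m}).$$ (ii) In particular, if $$\frac1q=\frac1p+\frac{\alpha+\beta-1}{n+m},$$ then there is a constant $S=S(n,m,p,\alpha,\beta)>0$ such that $$\||\hat x|^{-\beta}u\|_{L^q(\mathbb{R}^{n+m})}\le S\,\||\hat x|^{\alpha}\nabla u\|_{L^p(\mathbb{R}^{n+m})}\qquad\text{for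 all }u\in W_\alpha^{1,p}(\mathbb{R}^{n+m}).$$ In both cases the function space described above does realize the whole completion: for every sequence $(\varphi_k)$ in $C_c^\infty(\mathbb{R}^{n+m})$ that is Cauchy for the norm there are an element $u$ of the space and $f=Du$ as above with $\||\hat x|^{\alpha}(D\varphi_k-f)\|_{L^p(\mathbb{R}^{n+m})}\to0$ and $\||\hat x|^{-\beta}(\varphi_k-u)\|_{L^q(\mathbb{R}^{n+m})}\to0$. -/

import Mathlib

open MeasureTheory Filter Topology
open scoped ContDiff FourierTransform

noncomputable section

namespace PartialWeight

/-- The Euclidean space `ℝ^{n+m} = ℝ^n × ℝ^m`, whose points are `(x, x̂)` with `x ∈ ℝ^n`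
(the `Sum.inl` coordinates) and `x̂ ∈ ℝ^m` (the `Sum.inr` coordinates). -/
abbrev Space (n m : ℕ) : Type := EuclideanSpace ℝ (Fin n ⊕ Fin m)

/-- The component `x̂ ∈ ℝ^m` of a point `(x, x̂)` of `ℝ^{n+m}`. -/
def hat {n m : ℕ} (X : Space n m) : EuclideanSpace ℝ (Fin m) :=
  WithLp.toLp 2 fun j => X (Sum.inr j)

/-- The partial weight `(x, x̂) ↦ |x̂|^a`. -/
def weight {n m : ℕ} (a : ℝ) (X : Space n m) : ℝ := ‖hat X‖ ^ a

/-- The test functions, `C_c^∞(ℝ^{n+m})` (real-valued). -/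
def IsTest {n m : ℕ} (φ : Space n m → ℝ) : Prop :=
  ContDiff ℝ ∞ φ ∧ HasCompactSupport φ

/-- The fractional Laplacian `(-Δ)^{γ/2} φ`, the Fourier multiplier with symbol `(2π|ξ|)^γ`
(Mathlib's Fourier transform has the kernel `exp(-2πi⟨x, ξ⟩)`). For a real test function `φ` and
`γ > 0` the integrals converge absolutely and the inverse transform is real-valued, so that
the real part only changes the codomain. -/
def fracLaplacian {n m : ℕ} (γ : ℝ) (φ : Space n m → ℝ) (X : Space n m) : ℝ :=
  (𝓕⁻ (fun ξ : Space n m =>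
    (((2 * Real.pi * ‖ξ‖) ^ γ : ℝ) : ℂ) * 𝓕 (fun Y : Space n m => (φ Y : ℂ)) ξ) X).re

/-- The weighted seminorm distance `‖|x̂|^a (f - g)‖_{L^p(ℝ^{n+m})}`. -/
def wdist {n m : ℕ} {F : Type*} [NormedAddCommGroup F] [NormedSpace ℝ F]
    (a p : ℝ) (f g : Space n m → F) : ENNReal :=
  eLpNorm (fun X => weight a X • (f X - g X)) (ENNReal.ofReal p) volume

/-- A sequence of test functions that is Cauchy for the norm `φ ↦ ‖|x̂|^a D φ‖_{L^p}`. -/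
def IsCauchySeq {n m : ℕ} {F : Type*} [NormedAddCommGroup F] [NormedSpace ℝ F]
    (D : (Space n m → ℝ) → Space n m → F) (a p : ℝ) (φ : ℕ → Space n m → ℝ) : Prop :=
  (∀ k, IsTest (φ k)) ∧
    Tendsto (fun jk : ℕ × ℕ => wdist a p (D (φ jk.1)) (D (φ jk.2))) atTop (𝓝 0)

/-- `u` is an element of the completion of `C_c^∞(ℝ^{n+m})` for the norm
`φ ↦ ‖|x̂|^a D φ‖_{L^p}`, and `f` is the value `D u` of the operator `D`, extended to the
completion by continuity: there are test functions `φ k` with `φ k → u` almost everywhere and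
`|x̂|^a D (φ k) → |x̂|^a f` in `L^p`. -/
def InCompletion {n m : ℕ} {F : Type*} [NormedAddCommGroup F] [NormedSpace ℝ F]
    (D : (Space n m → ℝ) → Space n m → F) (a p : ℝ)
    (u : Space n m → ℝ) (f : Space n m → F) : Prop :=
  AEStronglyMeasurable f volume ∧
    ∃ φ : ℕ → Space n m → ℝ, (∀ k, IsTest (φ k)) ∧
      (∀ᵐ X, Tendsto (fun k => φ k X) atTop (𝓝 (u X))) ∧
      Tendsto (fun k => wdist a p (D (φ k)) f) atTop (𝓝 0)

/-- `u ∈ W_α^{γ,p}(ℝ^{n+m})` with `(-Δ)^{γ/2} u = f`. -/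
def InFracSobolev {n m : ℕ} (γ α p : ℝ) (u f : Space n m → ℝ) : Prop :=
  InCompletion (fracLaplacian γ) α p u f

/-- `u ∈ W_α^{1,p}(ℝ^{n+m})` with `∇u = G`. -/
def InGradSobolev {n m : ℕ} (α p : ℝ) (u : Space n m → ℝ) (G : Space n m → Space n m) : Prop :=
  InCompletion gradient α p u G

end PartialWeight

end

noncomputable section

open scoped ENNReal

namespace PartialWeight

/-! Put N = n + m. A test function φ is dominated pointwise by a multiple of the Riesz potential
|·|^{-(N-γ)} * |Dφ|, for D = (-Δ)^{γ/2}, and for D = ∇ with γ = 1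
(`exists_enorm_le_riesz_potential`, `exists_enorm_le_riesz_potential_fderiv`). It remains to bound
this potential on nonnegative functions, from L^p with the weight |x̂|^α to L^q with the weight
|x̂|^{-β} (`exists_stein_weiss_partial`).

The weights see only x̂, so the degree of the kernel is split as N - γ = s + t, where s = n(1 - 1/p
+ 1/q) is the Hardy–Littlewood–Sobolev degree on ℝ^n. For fixed x̂ ≠ ŷ, convolution in x maps
L^p(ℝ^n) to L^q(ℝ^n) with norm at most C|x̂ - ŷ|^{-t}: by Hardy–Littlewood–Sobolev if p < q, by
Young's inequality if p = q. Minkowski's integral inequality then leaves the classical Stein–Weiss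
inequality on ℝ^m, with kernel |x̂ - ŷ|^{-t}, for the function ŷ ↦ |ŷ|^α ‖F(·, ŷ)‖_p
(`exists_stein_weiss`).

In that inequality, where |x̂| and |ŷ| are not comparable, the kernel is at most a multiple of some
|x̂|^{-b}|ŷ|^{-a} of critical degree, and a Schur test applies (`lpn_kernel_le`); α < m/p' and β <
m/q make its integrals converge. Where they are comparable, α + β ≥ 0 reduces the kernel to the
Hardy–Littlewood–Sobolev one if p < q; if p = q then α + β = γ > 0, and the kernel has bounded
integrals in each variable.

In the completion, the inequality passes to limits by Fatou's lemma; applied to differences it shows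
that Cauchy sequences converge in the weighted L^q, which gives the function u. The hypotheses force
m > 0 and, in (ii), N > 1. -/

/-- The `L^p` norm of a nonnegative function. -/
def lpn {X : Type*} [MeasurableSpace X] (μ : Measure X) (p : ℝ) (f : X → ℝ≥0∞) : ℝ≥0∞ :=
  (∫⁻ x, f x ^ p ∂μ) ^ (1 / p)

/-! ### Minkowski's integral inequality and a Schur test from L^p to L^q. -/

section Lpn

variable {X Y : Type*} [MeasurableSpace X] [MeasurableSpace Y] {μ : Measure X} {ν : Measure Y}

lemma lpn_mono_ae {p : ℝ} (hp : 0 < p) {f g : X → ℝ≥0∞} (h : ∀ᵐ x ∂μ, f x ≤ g x) :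
    lpn μ p f ≤ lpn μ p g := by
  unfold lpn
  gcongr ?_ ^ _
  refine lintegral_mono_ae ?_
  filter_upwards [h] with x hx
  gcongr

lemma lpn_mono {p : ℝ} (hp : 0 < p) {f g : X → ℝ≥0∞} (h : ∀ x, f x ≤ g x) :
    lpn μ p f ≤ lpn μ p g :=
  lpn_mono_ae hp (Eventually.of_forall h)

lemma lpn_congr_ae {p : ℝ} {f g : X → ℝ≥0∞} (h : f =ᵐ[μ] g) : lpn μ p f = lpn μ p g := by
  unfold lpn
  congr 1
  refine lintegral_congr_ae ?_
  filter_upwards [h] with x hx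
  rw [hx]

lemma lpn_const_mul {p : ℝ} (hp : 0 < p) {c : ℝ≥0∞} (hc : c ≠ ⊤) (f : X → ℝ≥0∞) :
    lpn μ p (fun x => c * f x) = c * lpn μ p f := by
  unfold lpn
  simp_rw [ENNReal.mul_rpow_of_nonneg _ _ hp.le]
  rw [lintegral_const_mul' _ _ (by finiteness), ENNReal.mul_rpow_of_nonneg _ _ (by positivity),
    ← ENNReal.rpow_mul, mul_one_div_cancel hp.ne', ENNReal.rpow_one]

lemma lpn_rpow {p : ℝ} (hp : 0 < p) (f : X → ℝ≥0∞) : lpn μ p f ^ p = ∫⁻ x, f x ^ p ∂μ := by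
  unfold lpn
  rw [← ENNReal.rpow_mul, one_div_mul_cancel hp.ne', ENNReal.rpow_one]

lemma lpn_add_le {p : ℝ} (hp : 1 ≤ p) {f g : X → ℝ≥0∞} (hf : AEMeasurable f μ)
    (hg : AEMeasurable g μ) : lpn μ p (fun x => f x + g x) ≤ lpn μ p f + lpn μ p g :=
  ENNReal.lintegral_Lp_add_le hf hg hp

lemma lpn_comp {p : ℝ} {T : X → Y} (hT : MeasurePreserving T μ ν) {f : Y → ℝ≥0∞}
    (hf : Measurable f) : lpn μ p (fun x => f (T x)) = lpn ν p f := by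
  unfold lpn
  rw [hT.lintegral_comp (hf.pow_const p)]

/-- The duality step of Minkowski's integral inequality, for a truncation `H` of the integral. -/
lemma lpn_le_of_le_lintegral [SFinite μ] [SFinite ν] {r : ℝ} (hr : 1 < r) {F : X → Y → ℝ≥0∞}
    (hF : Measurable (Function.uncurry F)) {H : X → ℝ≥0∞} (hH : Measurable H)
    (hle : ∀ x, H x ≤ ∫⁻ y, F x y ∂ν) (hfin : lpn μ r H ≠ ⊤) :
    lpn μ r H ≤ ∫⁻ y, lpn μ r (fun x => F x y) ∂ν := by
  have hr0 : 0 < r := by linarith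
  have hc : r.HolderConjugate (r / (r - 1)) := Real.HolderConjugate.conjExponent hr
  have hFy : ∀ y, Measurable fun x => F x y := fun y => hF.comp (measurable_id.prodMk measurable_const)
  have hFx : ∀ x, Measurable fun y => F x y := fun x => hF.comp (measurable_const.prodMk measurable_id)
  rcases eq_or_ne (lpn μ r H) 0 with h0 | h0
  · simp [h0]
  -- Write H^r = H · H^{r-1}, bound the first factor by the integral, exchange the integrals and
  -- apply Hölder in x. The common factor ‖H‖^{r-1} can be cancelled only because it is finite and
  -- nonzero, which is why truncations come first.
  have key : lpn μ r H ^ r ≤ (∫⁻ y, lpn μ r (fun x => F x y) ∂ν) * lpn μ r H ^ (r - 1) := by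
    calc lpn μ r H ^ r = ∫⁻ x, H x ^ r ∂μ := lpn_rpow hr0 H
      _ ≤ ∫⁻ x, ∫⁻ y, F x y * H x ^ (r - 1) ∂ν ∂μ := by
          refine lintegral_mono fun x => ?_
          rw [lintegral_mul_const _ (hFx x)]
          calc H x ^ r = H x ^ (1 + (r - 1)) := by ring_nf
            _ = H x * H x ^ (r - 1) := by
              rw [ENNReal.rpow_add_of_nonneg _ _ zero_le_one (by linarith), ENNReal.rpow_one]
            _ ≤ _ := by gcongr; exact hle x
      _ = ∫⁻ y, ∫⁻ x, F x y * H x ^ (r - 1) ∂μ ∂ν := by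
          refine lintegral_lintegral_swap ?_
          exact (hF.mul ((hH.comp measurable_fst).pow_const _)).aemeasurable
      _ ≤ ∫⁻ y, lpn μ r (fun x => F x y) * lpn μ r H ^ (r - 1) ∂ν := by
          refine lintegral_mono fun y => ?_
          have := ENNReal.lintegral_mul_le_Lp_mul_Lq μ hc (hFy y).aemeasurable
            (hH.pow_const (r - 1)).aemeasurable
          refine this.trans_eq ?_
          unfold lpn
          congr 1
          have hr1 : r - 1 ≠ 0 := by linarith
          simp_rw [← ENNReal.rpow_mul]
          congr 2
          · ext x; congr 1; field_simp
          · field_simp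
      _ = _ := by
          rw [lintegral_mul_const']
          exact ENNReal.rpow_ne_top_of_nonneg (by linarith) hfin
  have hsplit : lpn μ r H ^ r = lpn μ r H * lpn μ r H ^ (r - 1) := by
    rw [show r = 1 + (r - 1) by ring, ENNReal.rpow_add_of_nonneg _ _ zero_le_one (by linarith),
      ENNReal.rpow_one]
    ring_nf
  rw [hsplit] at key
  exact (ENNReal.mul_le_mul_iff_left (by simp [h0, hfin])
    (ENNReal.rpow_ne_top_of_nonneg (by linarith) hfin)).1 key

/-- Minkowski's integral inequality. -/
theorem lpn_lintegral_le [SigmaFinite μ] [SFinite ν] {r : ℝ} (hr : 1 ≤ r) {F : X → Y → ℝ≥0∞}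
    (hF : Measurable (Function.uncurry F)) :
    lpn μ r (fun x => ∫⁻ y, F x y ∂ν) ≤ ∫⁻ y, lpn μ r (fun x => F x y) ∂ν := by
  rcases hr.eq_or_lt with rfl | hr
  · simp only [lpn, ENNReal.rpow_one, div_one]
    exact (lintegral_lintegral_swap hF.aemeasurable).le
  have hr0 : 0 < r := by linarith
  set G : X → ℝ≥0∞ := fun x => ∫⁻ y, F x y ∂ν with hG
  have hGm : Measurable G := hF.lintegral_prod_right
  -- Cut off at height k and to a set of finite measure: the norms become finite, and H k increases
  -- to G, so monotone convergence recovers the full statement.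
  set H : ℕ → X → ℝ≥0∞ := fun k => (spanningSets μ k).indicator fun x => min (G x) k with hHdef
  have hHm : ∀ k, Measurable (H k) := fun k =>
    (hGm.min measurable_const).indicator (measurableSet_spanningSets μ k)
  have hHle : ∀ k x, H k x ≤ G x := fun k x =>
    (Set.indicator_le_self _ _ x).trans (min_le_left _ _)
  have hHmono : Monotone H := by
    intro i j hij x
    refine (Set.indicator_le_indicator_of_subset (monotone_spanningSets μ hij) (by simp) x).trans ?_
    refine Set.indicator_le_indicator ?_
    gcongr
  have hHsup : ∀ x, ⨆ k, H k x = G x := by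
    intro x
    refine le_antisymm (iSup_le fun k => hHle k x) (le_of_forall_lt fun c hc => ?_)
    obtain ⟨k, hk⟩ := ENNReal.exists_nat_gt hc.ne_top
    obtain ⟨j, hj⟩ := Set.mem_iUnion.1 ((iUnion_spanningSets μ).symm ▸ Set.mem_univ x)
    refine lt_of_lt_of_le ?_ (le_iSup _ (max k j))
    have hx : x ∈ spanningSets μ (max k j) := monotone_spanningSets μ (le_max_right _ _) hj
    simp only [hHdef, Set.indicator_of_mem hx]
    refine lt_min hc (hk.trans_le ?_)
    exact_mod_cast le_max_left _ _
  have hfin : ∀ k, lpn μ r (H k) ≠ ⊤ := by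
    intro k
    unfold lpn
    refine ENNReal.rpow_ne_top_of_nonneg (by positivity) (ne_of_lt ?_)
    calc ∫⁻ x, H k x ^ r ∂μ ≤ ∫⁻ x, (spanningSets μ k).indicator (fun _ => (k : ℝ≥0∞) ^ r) x ∂μ := by
          refine lintegral_mono fun x => ?_
          by_cases hx : x ∈ spanningSets μ k
          · simp only [hHdef, Set.indicator_of_mem hx]
            gcongr
            exact min_le_right _ _
          · simp [hHdef, hx, hr0]
      _ = (k : ℝ≥0∞) ^ r * μ (spanningSets μ k) :=
          lintegral_indicator_const (measurableSet_spanningSets μ k) _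
      _ < ⊤ := ENNReal.mul_lt_top (by finiteness) (measure_spanningSets_lt_top μ k)
  have hk := fun k => lpn_le_of_le_lintegral hr hF (hHm k) (hHle k) (hfin k)
  have hGr : ∫⁻ x, G x ^ r ∂μ = ⨆ k, ∫⁻ x, H k x ^ r ∂μ := by
    rw [← lintegral_iSup (fun k => (hHm k).pow_const r)]
    · refine lintegral_congr fun x => ?_
      rw [← hHsup x]
      exact (ENNReal.orderIsoRpow r hr0).map_iSup _
    · intro i j hij x
      exact ENNReal.rpow_le_rpow (hHmono hij x) hr0.le
  rw [← ENNReal.rpow_le_rpow_iff hr0, lpn_rpow hr0, hGr]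
  refine iSup_le fun k => ?_
  rw [← lpn_rpow hr0]
  exact ENNReal.rpow_le_rpow (hk k) hr0.le

/-- An `L^p → L^q` criterion of Schur type for a kernel bounded by a product. -/
theorem lpn_kernel_le [SigmaFinite μ] [SFinite ν] {p p' q : ℝ} (hp : p.HolderConjugate p')
    (hpq : p ≤ q) {K₁ K₂ : X → Y → ℝ≥0∞} (hK₁ : Measurable (Function.uncurry K₁))
    (hK₂ : Measurable (Function.uncurry K₂)) {A : X → ℝ≥0∞} (hA : Measurable A) {B : ℝ≥0∞}
    (h₁ : ∀ᵐ x ∂μ, lpn ν p' (K₁ x) ≤ A x)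
    (h₂ : ∀ᵐ y ∂ν, lpn μ q (fun x => A x * K₂ x y) ≤ B)
    {f : Y → ℝ≥0∞} (hf : Measurable f) :
    lpn μ q (fun x => ∫⁻ y, K₁ x y * K₂ x y * f y ∂ν) ≤ B * lpn ν p f := by
  have hp0 : 0 < p := hp.pos
  have hq0 : 0 < q := hp0.trans_le hpq
  have hm₁ : ∀ x, Measurable (K₁ x) := fun x => hK₁.comp (measurable_const.prodMk measurable_id)
  have hm₂ : ∀ x, Measurable (K₂ x) := fun x => hK₂.comp (measurable_const.prodMk measurable_id)
  have hm₂' : ∀ y, Measurable fun x => K₂ x y := fun y =>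
    hK₂.comp (measurable_id.prodMk measurable_const)
  -- Hölder in y against K₁ costs the factor A x and leaves the L^p norm of K₂ f, that is, the
  -- integral of G to the power 1/p. As q/p ≥ 1, Minkowski in L^{q/p} then moves the x-norm inside,
  -- where the second hypothesis applies for each y.
  set G : X → Y → ℝ≥0∞ := fun x y => (A x * K₂ x y * f y) ^ p with hG
  have hGm : Measurable (Function.uncurry G) :=
    (((hA.comp measurable_fst).mul hK₂).mul (hf.comp measurable_snd)).pow_const p
  calc lpn μ q (fun x => ∫⁻ y, K₁ x y * K₂ x y * f y ∂ν)
      ≤ lpn μ q (fun x => (∫⁻ y, G x y ∂ν) ^ (1 / p)) := by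
        refine lpn_mono_ae hq0 ?_
        filter_upwards [h₁] with x hx
        simp_rw [mul_assoc]
        refine (ENNReal.lintegral_mul_le_Lp_mul_Lq ν hp.symm (hm₁ x).aemeasurable
          ((hm₂ x).mul hf).aemeasurable).trans ?_
        refine (mul_le_mul_left hx _).trans_eq ?_
        simp only [hG, mul_assoc]
        simp_rw [ENNReal.mul_rpow_of_nonneg (A x) _ hp0.le]
        have hm : Measurable fun y => (K₂ x y * f y) ^ p := ((hm₂ x).mul hf).pow_const p
        rw [lintegral_const_mul _ hm,
          ENNReal.mul_rpow_of_nonneg _ _ (by positivity), ← ENNReal.rpow_mul,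
          mul_one_div_cancel hp0.ne', ENNReal.rpow_one]
        rfl
    _ = (lpn μ (q / p) (fun x => ∫⁻ y, G x y ∂ν)) ^ (1 / p) := by
        unfold lpn
        simp_rw [← ENNReal.rpow_mul]
        congr 2
        · ext x; congr 1; field_simp
        · field_simp
    _ ≤ (∫⁻ y, lpn μ (q / p) (fun x => G x y) ∂ν) ^ (1 / p) := by
        gcongr
        exact lpn_lintegral_le ((one_le_div hp0).2 hpq) hGm
    _ ≤ (∫⁻ y, B ^ p * f y ^ p ∂ν) ^ (1 / p) := by
        gcongr ?_ ^ _
        refine lintegral_mono_ae ?_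
        filter_upwards [h₂] with y hy
        have : lpn μ (q / p) (fun x => G x y) = (lpn μ q fun x => A x * K₂ x y) ^ p * f y ^ p := by
          unfold lpn
          simp only [hG]
          have h1 : ∀ x, ((A x * K₂ x y * f y) ^ p) ^ (q / p)
              = (A x * K₂ x y) ^ q * f y ^ q := by
            intro x
            rw [← ENNReal.rpow_mul, mul_div_cancel₀ _ hp0.ne', ENNReal.mul_rpow_of_nonneg _ _ hq0.le]
          simp_rw [h1]
          have hm : Measurable fun x => (A x * K₂ x y) ^ q := (hA.mul (hm₂' y)).pow_const q
          rw [lintegral_mul_const _ hm,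
            ENNReal.mul_rpow_of_nonneg _ _ (by positivity), ← ENNReal.rpow_mul, ← ENNReal.rpow_mul]
          congr 2 <;> field_simp
        rw [this]
        gcongr
    _ = B * lpn ν p f := by
        rw [lintegral_const_mul _ (hf.pow_const p), ENNReal.mul_rpow_of_nonneg _ _ (by positivity),
          ← ENNReal.rpow_mul, mul_one_div_cancel hp0.ne', ENNReal.rpow_one]
        rfl

end Lpn

/-! ### Integrals of powers of the norm over balls, their complements and the whole space. -/

section PowerIntegrals

variable {E : Type*} [NormedAddCommGroup E] [InnerProductSpace ℝ E] [FiniteDimensional ℝ E]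
  [MeasurableSpace E] [BorelSpace E]

lemma lintegral_comp_smul {r : ℝ} (hr : 0 < r) (f : E → ℝ≥0∞) :
    ∫⁻ x, f x = ENNReal.ofReal r ^ (Module.finrank ℝ E : ℝ) * ∫⁻ x, f (r • x) := by
  have h := Measure.map_addHaar_smul (volume : Measure E) hr.ne'
  have h2 : ∫⁻ x, f (r • x) = ∫⁻ x, f x ∂(Measure.map (r • ·) (volume : Measure E)) :=
    (lintegral_map_equiv f (Homeomorph.smulOfNeZero r hr.ne').toMeasurableEquiv).symm
  rw [h2, h, lintegral_smul_measure, smul_eq_mul, ← mul_assoc, abs_of_nonneg (by positivity),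
    ENNReal.rpow_natCast, ← ENNReal.ofReal_pow hr.le, ← ENNReal.ofReal_mul (by positivity),
    mul_inv_cancel₀ (by positivity), ENNReal.ofReal_one, one_mul]

omit [FiniteDimensional ℝ E] [MeasurableSpace E] [BorelSpace E] in
lemma enorm_smul_of_pos {r : ℝ} (hr : 0 < r) (x : E) : ‖r • x‖ₑ = ENNReal.ofReal r * ‖x‖ₑ := by
  rw [enorm_smul, Real.enorm_of_nonneg hr.le]

/-- Only almost everywhere: for a < 0 the value at the origin is ⊤ in `ℝ≥0∞` but 0 in `ℝ`. -/
lemma enorm_rpow_ae_eq [Nontrivial E] (a : ℝ) :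
    (fun x : E => ‖x‖ₑ ^ a) =ᵐ[volume] fun x => ‖‖x‖ ^ a‖ₑ := by
  filter_upwards [Measure.ae_ne volume (0 : E)] with x hx
  rw [Real.enorm_of_nonneg (by positivity), ← ENNReal.ofReal_rpow_of_pos (norm_pos_iff.2 hx),
    ofReal_norm]

/-- Dilation by R. The set I of admissible radii is left free so that balls and their complements
are covered at once, reducing both to R = 1. -/
lemma setLIntegral_scale {a : ℝ} (I : Set ℝ≥0∞) {R : ℝ≥0∞} (hI : MeasurableSet I)
    (hR : R ≠ 0) (hR' : R ≠ ⊤) :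
    ∫⁻ x : E in {x | ‖x‖ₑ / R ∈ I}, ‖x‖ₑ ^ a =
      R ^ (Module.finrank ℝ E + a) * ∫⁻ x : E in {x | ‖x‖ₑ ∈ I}, ‖x‖ₑ ^ a := by
  have hr : 0 < R.toReal := ENNReal.toReal_pos hR hR'
  have hm : MeasurableSet {x : E | ‖x‖ₑ / R ∈ I} := (measurable_enorm.div_const R) hI
  have hm' : MeasurableSet {x : E | ‖x‖ₑ ∈ I} := measurable_enorm hI
  rw [← lintegral_indicator hm, ← lintegral_indicator hm', lintegral_comp_smul hr,
    ENNReal.ofReal_toReal hR', ENNReal.rpow_add _ _ hR hR', mul_assoc]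
  congr 1
  rw [← lintegral_const_mul' _ _ (ENNReal.rpow_ne_top_of_ne_zero hR hR')]
  refine lintegral_congr fun x => ?_
  have h1 : ‖R.toReal • x‖ₑ = R * ‖x‖ₑ := by
    rw [enorm_smul_of_pos hr, ENNReal.ofReal_toReal hR']
  have h2 : R * ‖x‖ₑ / R = ‖x‖ₑ := by rw [mul_comm, ENNReal.mul_div_cancel_right hR hR']
  have h3 : (R * ‖x‖ₑ) ^ a = R ^ a * ‖x‖ₑ ^ a := by
    rw [ENNReal.mul_rpow_of_ne_top hR' (by simp)]
  by_cases hx : ‖x‖ₑ ∈ I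
  · rw [Set.indicator_of_mem (by simpa [h1, h2] using hx), Set.indicator_of_mem (by simpa using hx),
      h1, h3]
  · rw [Set.indicator_of_notMem (by simpa [h1, h2] using hx),
      Set.indicator_of_notMem (by simpa using hx), mul_zero]

/-- Powers of the norm that are integrable at the origin. -/
lemma exists_setLIntegral_enorm_lt_le [Nontrivial E] {a : ℝ} (ha : -(Module.finrank ℝ E : ℝ) < a) :
    ∃ C : ℝ≥0∞, C ≠ ⊤ ∧ ∀ R : ℝ≥0∞, R ≠ 0 → R ≠ ⊤ →
      ∫⁻ x : E in {x | ‖x‖ₑ < R}, ‖x‖ₑ ^ a = C * R ^ (Module.finrank ℝ E + a) := by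
  refine ⟨∫⁻ x : E in {x | ‖x‖ₑ ∈ Set.Iio 1}, ‖x‖ₑ ^ a, ?_, fun R hR hR' => ?_⟩
  · have h : IntegrableOn (fun x : E => ‖x‖ ^ a) (Metric.ball 0 1) volume := by
      refine (integrableOn_fun_norm_addHaar (volume : Measure E) (f := fun r => r ^ a)).2 ?_
      have hd : 1 ≤ Module.finrank ℝ E := Module.finrank_pos
      refine IntegrableOn.congr_fun (f := fun y : ℝ => y ^ ((Module.finrank ℝ E : ℝ) - 1 + a)) ?_ ?_
        measurableSet_Ioo
      · exact (intervalIntegral.integrableOn_Ioo_rpow_iff one_pos).2 (by linarith)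
      · intro y hy
        simp only [smul_eq_mul]
        rw [Real.rpow_add hy.1, ← Real.rpow_natCast, Nat.cast_sub hd, Nat.cast_one]
    rw [lintegral_congr_ae (ae_restrict_of_ae (enorm_rpow_ae_eq a))]
    have hs : {x : E | ‖x‖ₑ ∈ Set.Iio 1} = Metric.ball 0 1 := by
      ext x
      simp [← ofReal_norm]
    rw [hs]
    exact h.2.ne
  · rw [mul_comm, ← setLIntegral_scale _ measurableSet_Iio hR hR']
    congr 3 with x
    simp [ENNReal.div_lt_iff (Or.inl hR) (Or.inl hR')]

/-- Powers of the norm that are integrable at infinity. -/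
lemma exists_setLIntegral_le_enorm_le [Nontrivial E] {a : ℝ} (ha : a < -(Module.finrank ℝ E : ℝ)) :
    ∃ C : ℝ≥0∞, C ≠ ⊤ ∧ ∀ R : ℝ≥0∞, R ≠ 0 → R ≠ ⊤ →
      ∫⁻ x : E in {x | R ≤ ‖x‖ₑ}, ‖x‖ₑ ^ a = C * R ^ (Module.finrank ℝ E + a) := by
  refine ⟨∫⁻ x : E in {x | ‖x‖ₑ ∈ Set.Ici 1}, ‖x‖ₑ ^ a, ?_, fun R hR hR' => ?_⟩
  · have h : Integrable (fun x : E => (Set.Ici 1).indicator (fun r : ℝ => r ^ a) ‖x‖) := by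
      refine (integrable_fun_norm_addHaar volume).2 ?_
      have hd : 1 ≤ Module.finrank ℝ E := Module.finrank_pos
      refine IntegrableOn.congr_fun (f := (Set.Ici 1).indicator
        fun y : ℝ => y ^ ((Module.finrank ℝ E : ℝ) - 1 + a)) ?_ ?_ measurableSet_Ioi
      · refine Integrable.integrableOn ((integrable_indicator_iff measurableSet_Ici).2 ?_)
        rw [integrableOn_Ici_iff_integrableOn_Ioi]
        exact integrableOn_Ioi_rpow_of_lt (by linarith) one_pos
      · intro y hy
        by_cases h1 : 1 ≤ y
        · simp only [smul_eq_mul, Set.indicator_of_mem (Set.mem_Ici.2 h1)]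
          rw [Real.rpow_add hy, ← Real.rpow_natCast, Nat.cast_sub hd, Nat.cast_one]
        · simp [h1]
    have hm : MeasurableSet {x : E | ‖x‖ₑ ∈ Set.Ici 1} := measurable_enorm measurableSet_Ici
    rw [← lintegral_indicator hm]
    refine ne_of_lt (lt_of_le_of_lt (lintegral_mono_ae ?_) h.2)
    filter_upwards [enorm_rpow_ae_eq (E := E) a] with x hx
    by_cases h1 : 1 ≤ ‖x‖
    · have h1' : 1 ≤ ‖x‖ₑ := by rwa [← ofReal_norm, ENNReal.one_le_ofReal]
      rw [Set.indicator_of_mem (by simpa using h1'), Set.indicator_of_mem (by simpa using h1), hx]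
    · have h1' : ¬ 1 ≤ ‖x‖ₑ := by rwa [← ofReal_norm, ENNReal.one_le_ofReal]
      rw [Set.indicator_of_notMem (by simpa using h1')]
      positivity
  · rw [mul_comm, ← setLIntegral_scale _ measurableSet_Ici hR hR']
    congr 3 with x
    simp [ENNReal.le_div_iff_mul_le (Or.inl hR) (Or.inl hR')]

/-- Dilation reduces to R = 1, where the decay at infinity suffices. The zero space is allowed,
because the case n = 0 needs it later. -/
lemma exists_lintegral_add_enorm_le {a : ℝ} (ha : a < -(Module.finrank ℝ E : ℝ)) :
    ∃ C : ℝ≥0∞, C ≠ ⊤ ∧ ∀ R : ℝ≥0∞, R ≠ 0 → R ≠ ⊤ →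
      ∫⁻ x : E, (‖x‖ₑ + R) ^ a = C * R ^ (Module.finrank ℝ E + a) := by
  refine ⟨∫⁻ x : E, (‖x‖ₑ + 1) ^ a, ?_, fun R hR hR' => ?_⟩
  · have := finite_integral_one_add_norm (μ := (volume : Measure E)) (r := -a) (by linarith)
    refine ne_of_lt ((lintegral_congr fun x => ?_).trans_lt this)
    rw [neg_neg, ← ENNReal.ofReal_rpow_of_pos (by positivity), ENNReal.ofReal_add zero_le_one
      (norm_nonneg _), ofReal_norm, ENNReal.ofReal_one, add_comm]
  · have hr : 0 < R.toReal := ENNReal.toReal_pos hR hR'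
    rw [lintegral_comp_smul hr, ENNReal.ofReal_toReal hR', ENNReal.rpow_add _ _ hR hR', mul_comm,
      mul_left_comm]
    rw [mul_comm (∫⁻ x : E, (‖x‖ₑ + 1) ^ a),
      ← lintegral_const_mul' _ _ (ENNReal.rpow_ne_top_of_ne_zero hR hR'), mul_comm]
    congr 1
    refine lintegral_congr fun x => ?_
    rw [enorm_smul_of_pos hr, ENNReal.ofReal_toReal hR', ← ENNReal.mul_rpow_of_ne_top hR' (by simp),
      mul_add, mul_one]

end PowerIntegrals

/-! ### The Hardy–Littlewood–Sobolev inequality, from level sets. -/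

/-- The layer cake formula for a single value. -/
lemma lintegral_Ioi_indicator_rpow {c : ℝ} (hc : 0 < c) (u : ℝ≥0∞) :
    ∫⁻ l in Set.Ioi (0 : ℝ), (if ENNReal.ofReal l < u then ENNReal.ofReal l ^ (c - 1) else 0) =
      u ^ c / ENNReal.ofReal c := by
  have hfin : ∀ r : ℝ, 0 ≤ r → ∫⁻ l in Set.Ioi (0 : ℝ),
      (if ENNReal.ofReal l < ENNReal.ofReal r then ENNReal.ofReal l ^ (c - 1) else 0) =
      ENNReal.ofReal r ^ c / ENNReal.ofReal c := by
    intro r hr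
    have h1 : ∫⁻ l in Set.Ioi (0 : ℝ),
        (if ENNReal.ofReal l < ENNReal.ofReal r then ENNReal.ofReal l ^ (c - 1) else 0) =
        ∫⁻ l in Set.Ioo (0 : ℝ) r, ENNReal.ofReal (l ^ (c - 1)) := by
      rw [← lintegral_indicator measurableSet_Ioi, ← lintegral_indicator measurableSet_Ioo]
      refine lintegral_congr fun l => ?_
      by_cases hl : 0 < l
      · by_cases hlr : l < r
        · have h3 := hl.trans hlr
          simp [Set.indicator, hl, hlr, h3, ENNReal.ofReal_rpow_of_pos hl]
        · simp [Set.indicator, hl, hlr, ENNReal.ofReal_lt_ofReal_iff_of_nonneg hl.le]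
      · simp [Set.indicator, hl]
    rw [h1, setLIntegral_congr Ioo_ae_eq_Ioc, ← ofReal_integral_eq_lintegral_ofReal,
      ← intervalIntegral.integral_of_le hr, integral_rpow (Or.inl (by linarith)),
      sub_add_cancel, Real.zero_rpow hc.ne', sub_zero, ENNReal.ofReal_div_of_pos hc,
      ENNReal.ofReal_rpow_of_nonneg hr hc.le]
    · exact (intervalIntegral.intervalIntegrable_rpow' (by linarith)).1
    · filter_upwards [ae_restrict_mem measurableSet_Ioc] with l hl
      exact Real.rpow_nonneg hl.1.le _
  rcases eq_or_ne u ⊤ with rfl | hu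
  · rw [ENNReal.top_rpow_of_pos hc, ENNReal.top_div_of_ne_top ENNReal.ofReal_ne_top,
      eq_top_iff]
    have hlim : Tendsto (fun r : ℝ => ENNReal.ofReal r ^ c / ENNReal.ofReal c) atTop (𝓝 ⊤) := by
      have h2 : Tendsto (fun r : ℝ => ENNReal.ofReal (r ^ c / c)) atTop (𝓝 ⊤) :=
        ENNReal.tendsto_ofReal_atTop.comp ((tendsto_rpow_atTop hc).atTop_div_const hc)
      refine h2.congr' ?_
      filter_upwards [eventually_ge_atTop 0] with r hr
      rw [ENNReal.ofReal_div_of_pos hc, ENNReal.ofReal_rpow_of_nonneg hr hc.le]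
    refine le_of_tendsto hlim ?_
    filter_upwards [eventually_ge_atTop 0] with r hr
    rw [← hfin r hr]
    refine lintegral_mono fun l => ?_
    by_cases h : ENNReal.ofReal l < ENNReal.ofReal r
    · rw [if_pos h, if_pos (by simp)]
    · rw [if_neg h]; positivity
  · simpa [ENNReal.ofReal_toReal hu] using hfin u.toReal ENNReal.toReal_nonneg

section HardyLittlewoodSobolev

variable {E : Type*} [NormedAddCommGroup E] [InnerProductSpace ℝ E] [FiniteDimensional ℝ E]
  [MeasurableSpace E] [BorelSpace E]

/-- A pointwise bound for the Riesz potential of a function of unit `L^p` norm: up to a multiple of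
`l`, only the part of the kernel near the origin and the part of the function above the height
`l ^ (q / p)` contribute. -/
lemma exists_riesz_potential_le [Nontrivial E] {p q s : ℝ} (hp : 1 < p) (hpq : p < q)
    (hs : s = (Module.finrank ℝ E : ℝ) * (1 - 1 / p + 1 / q)) :
    ∃ B A : ℝ≥0∞, B ≠ ⊤ ∧ A ≤ B ∧ B ≠ 0 ∧ ∀ l : ℝ≥0∞, l ≠ 0 → l ≠ ⊤ → ∃ k : E → ℝ≥0∞,
      Measurable k ∧ ∫⁻ z, k z = A * l ^ (1 - q / p) ∧
      ∀ f : E → ℝ≥0∞, Measurable f → ∫⁻ y, f y ^ p ≤ 1 → ∀ x,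
        ∫⁻ y, ‖x - y‖ₑ ^ (-s) * f y ≤
          B * l + ∫⁻ y, k (x - y) * (if l ^ (q / p) < f y then f y else 0) := by
  have hp0 : 0 < p := by linarith
  have hq0 : 0 < q := by linarith
  set d : ℝ := (Module.finrank ℝ E : ℝ) with hd
  have hd0 : 0 < d := by
    rw [hd]
    exact_mod_cast Module.finrank_pos (R := ℝ) (M := E)
  set p' := p / (p - 1) with hp'
  have hc : p.HolderConjugate p' := Real.HolderConjugate.conjExponent hp
  have hp'0 : 0 < p' := hc.symm.pos
  have hinv : 1 / p' = 1 - 1 / p := by have := hc.inv_add_inv_eq_one; simp only [one_div]; linarith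
  have hlt : 1 / q < 1 / p := one_div_lt_one_div_of_lt hp0 hpq
  have hsd : s < d := by rw [hs]; nlinarith
  have hdp : d / p' - s = - (d / q) := by
    rw [hs, div_eq_mul_one_div, hinv]; ring
  have hdq : 0 < d / q := by positivity
  have hsp : d < s * p' := by
    have : d / p' < s := by linarith
    rwa [div_lt_iff₀ hp'0] at this
  obtain ⟨A₁, hA₁, hfar⟩ := exists_setLIntegral_le_enorm_le (E := E) (a := -(s * p')) (by linarith)
  obtain ⟨A₂, hA₂, hnear⟩ := exists_setLIntegral_enorm_lt_le (E := E) (a := -s) (by linarith)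
  -- The summand 1 makes B nonzero, so that later divisions by B l are legitimate.
  refine ⟨A₁ ^ (1 / p') + A₂ + 1, A₂, ?_, ?_, by simp, fun l hl hl' => ?_⟩
  · have := ENNReal.rpow_ne_top_of_nonneg (y := 1 / p') (by positivity) hA₁
    finiteness
  · exact le_add_right le_add_self
  -- The radius is chosen so that Hölder on |x - y| ≥ R gives R^{d/p' - s} = R^{-d/q} = l. The
  -- height h is chosen so that the near kernel, of mass A₂ R^{d-s} = A₂ l^{1 - q/p}, contributes at
  -- most A₂ l on the values of f below h.
  set R : ℝ≥0∞ := l ^ (-(q / d)) with hR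
  set h : ℝ≥0∞ := l ^ (q / p) with hh
  have hR0 : R ≠ 0 := by
    rw [hR]; exact (ENNReal.rpow_pos (pos_iff_ne_zero.2 hl) hl').ne'
  have hR1 : R ≠ ⊤ := ENNReal.rpow_ne_top_of_ne_zero hl hl'
  have hRd : R ^ (d + -s) = l ^ (1 - q / p) := by
    rw [hR, ← ENNReal.rpow_mul]
    congr 1
    rw [hs]; field_simp; ring
  have hms : MeasurableSet {z : E | ‖z‖ₑ < R} := measurable_enorm measurableSet_Iio
  have hms' : MeasurableSet {z : E | R ≤ ‖z‖ₑ} := measurable_enorm measurableSet_Ici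
  set k : E → ℝ≥0∞ := {z : E | ‖z‖ₑ < R}.indicator fun z => ‖z‖ₑ ^ (-s) with hk
  set K : E → ℝ≥0∞ := {z : E | R ≤ ‖z‖ₑ}.indicator fun z => ‖z‖ₑ ^ (-s) with hK
  have hmk : Measurable k := (measurable_enorm.pow_const _).indicator hms
  have hmK : Measurable K := (measurable_enorm.pow_const _).indicator hms'
  have hkint : ∫⁻ z, k z = A₂ * l ^ (1 - q / p) := by
    rw [hk, lintegral_indicator hms, hnear R hR0 hR1, hRd]
  refine ⟨k, hmk, hkint, fun f hf hf1 x => ?_⟩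
  have hkx : Measurable fun y => k (x - y) := hmk.comp (measurable_const.sub measurable_id)
  have hKx : Measurable fun y => K (x - y) := hmK.comp (measurable_const.sub measurable_id)
  have hfh : Measurable fun y => if h < f y then f y else 0 :=
    Measurable.ite (measurableSet_lt measurable_const hf) hf measurable_const
  have hpt : ∀ y, ‖x - y‖ₑ ^ (-s) * f y ≤
      K (x - y) * f y + (k (x - y) * h + k (x - y) * (if h < f y then f y else 0)) := by
    intro y
    by_cases hy : ‖x - y‖ₑ < R
    · have h1 : k (x - y) = ‖x - y‖ₑ ^ (-s) := Set.indicator_of_mem (by exact hy) _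
      rw [h1, ← mul_add]
      refine le_add_left ?_
      gcongr
      split_ifs with hlt
      · exact le_add_self
      · simpa using hlt
    · have h1 : K (x - y) = ‖x - y‖ₑ ^ (-s) := Set.indicator_of_mem (by simpa using hy) _
      rw [h1]
      exact le_self_add
  have hI₁ : ∫⁻ y, K (x - y) * f y ≤ A₁ ^ (1 / p') * l := by
    refine (ENNReal.lintegral_mul_le_Lp_mul_Lq volume hc.symm hKx.aemeasurable
      hf.aemeasurable).trans ?_
    have h1 : (∫⁻ y, f y ^ p) ^ (1 / p) ≤ 1 := ENNReal.rpow_le_one hf1 (by positivity)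
    refine (mul_le_mul_right h1 _).trans_eq ?_
    rw [mul_one, lintegral_sub_left_eq_self (fun y => K y ^ p') x]
    have h2 : ∫⁻ z, K z ^ p' = A₁ * R ^ (d + -(s * p')) := by
      rw [← hfar R hR0 hR1, ← lintegral_indicator hms']
      refine lintegral_congr fun z => ?_
      simp only [hK, Set.indicator_apply]
      split_ifs
      · rw [← ENNReal.rpow_mul]; ring_nf
      · rw [ENNReal.zero_rpow_of_pos hp'0]
    rw [h2, ENNReal.mul_rpow_of_nonneg _ _ (by positivity), ← ENNReal.rpow_mul, hR,
      ← ENNReal.rpow_mul]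
    have h3 : -(q / d) * ((d + -(s * p')) * (1 / p')) = 1 := by
      have : (d + -(s * p')) * (1 / p') = d / p' - s := by field_simp; ring
      rw [this, hdp]; field_simp
    rw [h3, ENNReal.rpow_one]
  have hI₂ : ∫⁻ y, k (x - y) * h = A₂ * l := by
    rw [lintegral_mul_const _ hkx, lintegral_sub_left_eq_self k x, hkint, mul_assoc, hh,
      ← ENNReal.rpow_add _ _ hl hl', sub_add_cancel, ENNReal.rpow_one]
  calc ∫⁻ y, ‖x - y‖ₑ ^ (-s) * f y
      ≤ ∫⁻ y, (K (x - y) * f y + (k (x - y) * h + k (x - y) * (if h < f y then f y else 0))) :=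
        lintegral_mono hpt
    _ = (∫⁻ y, K (x - y) * f y) + ((∫⁻ y, k (x - y) * h) +
          ∫⁻ y, k (x - y) * (if h < f y then f y else 0)) := by
        have hm₁ : Measurable fun y => K (x - y) * f y := hKx.mul hf
        have hm₂ : Measurable fun y => k (x - y) * h := hkx.mul_const h
        rw [lintegral_add_left hm₁, lintegral_add_left hm₂]
    _ ≤ A₁ ^ (1 / p') * l + (A₂ * l + ∫⁻ y, k (x - y) * (if h < f y then f y else 0)) := by
        rw [hI₂]; gcongr
    _ ≤ _ := by
        rw [← add_assoc, ← add_mul]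
        exact add_le_add (mul_le_mul_left le_self_add _) le_rfl

/-- The strong bound comes without interpolation, because the level-set estimate retains the
truncation f > l^{q/p} on its right-hand side. Integrated against q l^{q-1} dl, Tonelli turns it
into ∫ f · f^{p-1}, up to a constant; the l-integral converges at 0 since p > 1 gives q - q/p > 0.
-/
lemma exists_lintegral_riesz_potential_rpow_le [Nontrivial E] {p q s : ℝ} (hp : 1 < p)
    (hpq : p < q) (hs : s = (Module.finrank ℝ E : ℝ) * (1 - 1 / p + 1 / q)) :
    ∃ C : ℝ≥0∞, C ≠ ⊤ ∧ ∀ f : E → ℝ≥0∞, Measurable f → ∫⁻ y, f y ^ p ≤ 1 →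
      ∫⁻ x, (∫⁻ y, ‖x - y‖ₑ ^ (-s) * f y) ^ q ≤ C := by
  have hp0 : 0 < p := by linarith
  have hq0 : 0 < q := by linarith
  obtain ⟨B, A, hB, hAB, hB0, hpt⟩ := exists_riesz_potential_le (E := E) hp hpq hs
  have he : 0 < q - q / p := by
    have : q / p < q := div_lt_self hq0 hp
    linarith
  refine ⟨(2 * B) ^ q * (ENNReal.ofReal q * (ENNReal.ofReal (q - q / p))⁻¹), ?_,
    fun f hf hf1 => ?_⟩
  · have : (ENNReal.ofReal (q - q / p))⁻¹ ≠ ⊤ := by simpa using he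
    finiteness
  set T : E → ℝ≥0∞ := fun x => ∫⁻ y, ‖x - y‖ₑ ^ (-s) * f y with hT
  have hTm : Measurable T := by
    refine Measurable.lintegral_prod_right' (f := fun z : E × E => ‖z.1 - z.2‖ₑ ^ (-s) * f z.2) ?_
    exact ((measurable_fst.sub measurable_snd).enorm.pow_const _).mul (hf.comp measurable_snd)
  have h2B0 : 2 * B ≠ 0 := by simp [hB0]
  have h2B : 2 * B ≠ ⊤ := by finiteness
  -- Where T > 2Bl, the part B l of the pointwise bound leaves N ≥ B l for the remaining convolution
  -- N. Markov's inequality and ∫ N = A l^{1-q/p} ∫ g conclude, with A/B ≤ 1.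
  have hlevel : ∀ l : ℝ≥0∞, l ≠ 0 → l ≠ ⊤ → volume {x | l < T x / (2 * B)} ≤
      l ^ (-(q / p)) * ∫⁻ y, (if l ^ (q / p) < f y then f y else 0) := by
    intro l hl hl'
    obtain ⟨k, hk, hkint, hkT⟩ := hpt l hl hl'
    set g : E → ℝ≥0∞ := fun y => if l ^ (q / p) < f y then f y else 0 with hg
    have hgm : Measurable g :=
      Measurable.ite (measurableSet_lt measurable_const hf) hf measurable_const
    have hkm : Measurable fun z : E × E => k (z.1 - z.2) * g z.2 :=
      (hk.comp (measurable_fst.sub measurable_snd)).mul (hgm.comp measurable_snd)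
    set N : E → ℝ≥0∞ := fun x => ∫⁻ y, k (x - y) * g y with hN
    have hNm : Measurable N := hkm.lintegral_prod_right
    have hBl0 : B * l ≠ 0 := mul_ne_zero hB0 hl
    have hBl : B * l ≠ ⊤ := by finiteness
    have hsub : {x | l < T x / (2 * B)} ⊆ {x | B * l ≤ N x} := by
      intro x hx
      have h1 : l * (2 * B) < T x := (ENNReal.lt_div_iff_mul_lt (Or.inl h2B0) (Or.inl h2B)).1 hx
      have h2 : B * l + B * l < B * l + N x := by
        calc B * l + B * l = l * (2 * B) := by ring
          _ < T x := h1
          _ ≤ _ := hkT f hf hf1 x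
      exact ((ENNReal.add_lt_add_iff_left hBl).1 h2).le
    have hNint : ∫⁻ x, N x = A * l ^ (1 - q / p) * ∫⁻ y, g y := by
      rw [hN, lintegral_lintegral_swap hkm.aemeasurable, ← lintegral_const_mul _ hgm]
      refine lintegral_congr fun y => ?_
      have hm : Measurable fun x => k (x - y) := hk.comp (measurable_id.sub measurable_const)
      rw [lintegral_mul_const _ hm,
        lintegral_sub_right_eq_self k y, hkint]
    calc volume {x | l < T x / (2 * B)} ≤ volume {x | B * l ≤ N x} := measure_mono hsub
      _ ≤ (∫⁻ x, N x) / (B * l) := meas_ge_le_lintegral_div hNm.aemeasurable hBl0 hBl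
      _ ≤ _ := by
        refine ENNReal.div_le_of_le_mul ?_
        rw [hNint]
        have h3 : l ^ (-(q / p)) * (∫⁻ y, g y) * (B * l) =
            B * l ^ (1 - q / p) * ∫⁻ y, g y := by
          rw [sub_eq_neg_add, ENNReal.rpow_add _ _ hl hl', ENNReal.rpow_one]; ring
        rw [h3]
        gcongr
  have hcake : ∫⁻ x, (T x / (2 * B)) ^ q ≤
      ENNReal.ofReal q * (ENNReal.ofReal (q - q / p))⁻¹ := by
    have hq1 : ∀ u : ℝ≥0∞, u ^ q = ENNReal.ofReal q * ∫⁻ l in Set.Ioi (0 : ℝ),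
        (if ENNReal.ofReal l < u then ENNReal.ofReal l ^ (q - 1) else 0) := by
      intro u
      rw [lintegral_Ioi_indicator_rpow hq0, ENNReal.mul_div_cancel (by simpa using hq0) (by simp)]
    have hmeas : ∀ (r : ℝ) (u : E → ℝ≥0∞), Measurable u → Measurable (Function.uncurry
        fun (x : E) (l : ℝ) => if ENNReal.ofReal l < u x then ENNReal.ofReal l ^ r else 0) := by
      intro r u hu
      refine Measurable.ite (measurableSet_lt (ENNReal.measurable_ofReal.comp measurable_snd)
        (hu.comp measurable_fst)) ?_ measurable_const
      exact (ENNReal.measurable_ofReal.comp measurable_snd).pow_const r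
    have hTd : Measurable fun x => T x / (2 * B) := hTm.div_const _
    have hfp : Measurable fun y => f y ^ (p / q) := hf.pow_const _
    calc ∫⁻ x, (T x / (2 * B)) ^ q
        = ENNReal.ofReal q * ∫⁻ x, ∫⁻ l in Set.Ioi (0 : ℝ),
            (if ENNReal.ofReal l < T x / (2 * B) then ENNReal.ofReal l ^ (q - 1) else 0) := by
          rw [← lintegral_const_mul' _ _ (by simp)]
          exact lintegral_congr fun x => hq1 _
      _ = ENNReal.ofReal q * ∫⁻ l in Set.Ioi (0 : ℝ), ∫⁻ x,
            (if ENNReal.ofReal l < T x / (2 * B) then ENNReal.ofReal l ^ (q - 1) else 0) := by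
          rw [lintegral_lintegral_swap (hmeas _ _ hTd).aemeasurable]
      -- The condition l^{q/p} < f y is restated as l < (f y)^{p/q}, so that after exchanging the
      -- integrals the layer cake formula applies with exponent q - q/p.
      _ ≤ ENNReal.ofReal q * ∫⁻ l in Set.Ioi (0 : ℝ), ∫⁻ y, f y *
            (if ENNReal.ofReal l < f y ^ (p / q) then
              ENNReal.ofReal l ^ ((q - q / p) - 1) else 0) := by
          refine mul_le_mul_right ?_ _
          refine setLIntegral_mono' measurableSet_Ioi fun l hl => ?_
          have hl0 : ENNReal.ofReal l ≠ 0 := by simpa using hl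
          have hl1 : ENNReal.ofReal l ≠ ⊤ := by simp
          have hiff : ∀ y, ENNReal.ofReal l < f y ^ (p / q) ↔ ENNReal.ofReal l ^ (q / p) < f y := by
            intro y
            have : f y = (f y ^ (p / q)) ^ (q / p) := by
              rw [← ENNReal.rpow_mul]; field_simp; simp
            nth_rewrite 2 [this]
            exact (ENNReal.rpow_lt_rpow_iff (by positivity)).symm
          have hL : ∫⁻ x, (if ENNReal.ofReal l < T x / (2 * B) then
              ENNReal.ofReal l ^ (q - 1) else 0) =
              ENNReal.ofReal l ^ (q - 1) * volume {x | ENNReal.ofReal l < T x / (2 * B)} := by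
            rw [← lintegral_indicator_const (measurableSet_lt measurable_const hTd)]
            refine lintegral_congr fun x => ?_
            simp [Set.indicator_apply]
          have hRt : ∀ y, f y * (if ENNReal.ofReal l < f y ^ (p / q) then
              ENNReal.ofReal l ^ ((q - q / p) - 1) else 0) = ENNReal.ofReal l ^ ((q - q / p) - 1) *
              (if ENNReal.ofReal l ^ (q / p) < f y then f y else 0) := by
            intro y
            simp only [hiff y]
            split_ifs
            · ring
            · simp
          rw [hL]
          simp_rw [hRt]
          rw [lintegral_const_mul' _ _ (ENNReal.rpow_ne_top_of_ne_zero hl0 hl1)]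
          refine (mul_le_mul_right (hlevel _ hl0 hl1) _).trans_eq ?_
          rw [← mul_assoc, ← ENNReal.rpow_add _ _ hl0 hl1]
          congr 2
          ring
      _ = ENNReal.ofReal q * ∫⁻ y, f y * ∫⁻ l in Set.Ioi (0 : ℝ),
            (if ENNReal.ofReal l < f y ^ (p / q) then
              ENNReal.ofReal l ^ ((q - q / p) - 1) else 0) := by
          have hm := hmeas ((q - q / p) - 1) _ hfp
          rw [← lintegral_lintegral_swap (((hf.comp measurable_fst).mul hm).aemeasurable)]
          congr 1
          refine lintegral_congr fun y => ?_
          exact lintegral_const_mul _ (hm.comp (measurable_const.prodMk measurable_id))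
      _ = ENNReal.ofReal q * ∫⁻ y, f y ^ p * (ENNReal.ofReal (q - q / p))⁻¹ := by
          congr 1
          refine lintegral_congr fun y => ?_
          rw [lintegral_Ioi_indicator_rpow he, div_eq_mul_inv, ← mul_assoc, ← ENNReal.rpow_mul]
          congr 1
          have h1 : p / q * (q - q / p) = p - 1 := by field_simp
          rw [h1]
          nth_rewrite 1 [← ENNReal.rpow_one (f y)]
          rw [← ENNReal.rpow_add_of_nonneg _ _ zero_le_one (by linarith), add_sub_cancel]
      _ ≤ _ := by
          rw [lintegral_mul_const _ (hf.pow_const p)]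
          gcongr
          exact mul_le_of_le_one_left' hf1
  calc ∫⁻ x, T x ^ q = ∫⁻ x, (2 * B) ^ q * (T x / (2 * B)) ^ q := by
        refine lintegral_congr fun x => ?_
        rw [← ENNReal.mul_rpow_of_nonneg _ _ hq0.le, ENNReal.mul_div_cancel h2B0 h2B]
    _ = (2 * B) ^ q * ∫⁻ x, (T x / (2 * B)) ^ q := by
        rw [lintegral_const_mul' _ _ (by finiteness)]
    _ ≤ _ := by gcongr

/-- The Hardy–Littlewood–Sobolev inequality. -/
theorem exists_hardy_littlewood_sobolev [Nontrivial E] {p q s : ℝ} (hp : 1 < p) (hpq : p < q)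
    (hs : s = (Module.finrank ℝ E : ℝ) * (1 - 1 / p + 1 / q)) :
    ∃ C : ℝ≥0∞, C ≠ ⊤ ∧ ∀ f : E → ℝ≥0∞, Measurable f →
      lpn volume q (fun x => ∫⁻ y, ‖x - y‖ₑ ^ (-s) * f y) ≤ C * lpn volume p f := by
  have hp0 : 0 < p := by linarith
  have hq0 : 0 < q := by linarith
  obtain ⟨C, hC, h⟩ := exists_lintegral_riesz_potential_rpow_le (E := E) hp hpq hs
  -- A nonzero constant, so that the right-hand side is ⊤ when ‖f‖_p = ⊤.
  refine ⟨C ^ (1 / q) + 1, by finiteness, fun f hf => ?_⟩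
  rcases eq_or_ne (lpn volume p f) ⊤ with htop | htop
  · simp [htop]
  rcases eq_or_ne (lpn volume p f) 0 with hzero | hzero
  · have h0 : ∫⁻ y, f y ^ p = 0 := by
      rw [← lpn_rpow hp0, hzero, ENNReal.zero_rpow_of_pos hp0]
    have hf0 : f =ᵐ[volume] 0 := ENNReal.ae_eq_zero_of_lintegral_rpow_eq_zero hp0.le
      hf.aemeasurable h0
    have : ∀ x, ∫⁻ y, ‖x - y‖ₑ ^ (-s) * f y = 0 := by
      intro x
      rw [← lintegral_zero (μ := (volume : Measure E))]
      refine lintegral_congr_ae ?_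
      filter_upwards [hf0] with y hy
      simp [hy]
    simp [this, lpn, hq0]
  set N := lpn volume p f with hN
  have hg : ∫⁻ y, (N⁻¹ * f y) ^ p ≤ 1 := by
    rw [← lpn_rpow hp0, lpn_const_mul hp0 (by simpa using hzero), ← hN,
      ENNReal.inv_mul_cancel hzero htop, ENNReal.one_rpow]
  have key := h _ (hf.const_mul N⁻¹) hg
  have hT : ∀ x, ∫⁻ y, ‖x - y‖ₑ ^ (-s) * f y =
      N * ∫⁻ y, ‖x - y‖ₑ ^ (-s) * (N⁻¹ * f y) := by
    intro x
    rw [← lintegral_const_mul' _ _ htop]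
    refine lintegral_congr fun y => ?_
    rw [mul_left_comm, ← mul_assoc N, ENNReal.mul_inv_cancel hzero htop, one_mul]
  simp_rw [hT]
  rw [lpn_const_mul hq0 htop, mul_comm]
  gcongr
  refine le_add_right ?_
  unfold lpn
  gcongr

end HardyLittlewoodSobolev

/-! ### The Stein–Weiss inequality: off-diagonal parts of Hardy type and the diagonal part. -/

lemma ennreal_rpow_anti {x y : ℝ≥0∞} {z : ℝ} (hz : z ≤ 0) (h : x ≤ y) : y ^ z ≤ x ^ z := by
  rw [← neg_neg z, ENNReal.rpow_neg x, ENNReal.rpow_neg y, ENNReal.inv_le_inv]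
  exact ENNReal.rpow_le_rpow h (by linarith)

/-- A single factor serves both signs of u: y ≤ c x is used for u ≥ 0, and x ≤ c y for u ≤ 0. -/
lemma ennreal_rpow_comparable {x y c : ℝ≥0∞} (hy : y ≠ ⊤) (hc : c ≠ ⊤) (hc0 : c ≠ 0)
    (h₁ : x ≤ c * y) (h₂ : y ≤ c * x) (u : ℝ) : y ^ u ≤ c ^ |u| * x ^ u := by
  rcases le_total 0 u with hu | hu
  · rw [abs_of_nonneg hu, ← ENNReal.mul_rpow_of_nonneg _ _ hu]
    exact ENNReal.rpow_le_rpow h₂ hu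
  · rw [abs_of_nonpos hu]
    calc y ^ u = c ^ (-u) * (c * y) ^ u := by
          rw [ENNReal.mul_rpow_of_ne_top hc hy, ← mul_assoc, ← ENNReal.rpow_add _ _ hc0 hc]
          simp
      _ ≤ _ := mul_le_mul_right (ennreal_rpow_anti hu h₁) _

section SteinWeiss

variable {E : Type*} [NormedAddCommGroup E] [InnerProductSpace ℝ E] [FiniteDimensional ℝ E]
  [MeasurableSpace E] [BorelSpace E]

/-- Boundedness of a kernel `|x|^{-b} |y|^{-a}`, homogeneous of the critical degree, on an
intersection of two regions which control one integral each. -/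
lemma lpn_hardy_le [Nontrivial E] {p p' q a b σ : ℝ} (hp : p.HolderConjugate p') (hpq : p ≤ q)
    (hab : a + b = (Module.finrank ℝ E : ℝ) * (1 / p' + 1 / q)) {S₁ S₂ : Set (E × E)}
    (hS₁ : MeasurableSet S₁) (hS₂ : MeasurableSet S₂) {C₁ C₂ : ℝ≥0∞}
    (hC₁ : C₁ ≠ ⊤) (hC₂ : C₂ ≠ ⊤)
    (h₁ : ∀ x : E, x ≠ 0 → ∫⁻ y : E in {y | (x, y) ∈ S₁}, ‖y‖ₑ ^ (-(σ * p')) ≤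
      C₁ * ‖x‖ₑ ^ (Module.finrank ℝ E + -(σ * p')))
    (h₂ : ∀ y : E, y ≠ 0 →
      ∫⁻ x : E in {x | (x, y) ∈ S₂}, ‖x‖ₑ ^ ((Module.finrank ℝ E / p' - σ - b) * q) ≤
      C₂ * ‖y‖ₑ ^ (Module.finrank ℝ E + (Module.finrank ℝ E / p' - σ - b) * q)) :
    ∃ C : ℝ≥0∞, C ≠ ⊤ ∧ ∀ f : E → ℝ≥0∞, Measurable f →
      lpn volume q (fun x => ∫⁻ y, (S₁ ∩ S₂).indicator (fun z => ‖z.1‖ₑ ^ (-b) * ‖z.2‖ₑ ^ (-a)) (x, y)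
        * f y) ≤ C * lpn volume p f := by
  classical
  have hp0 : 0 < p := hp.pos
  have hp'0 : 0 < p' := hp.symm.pos
  have hq0 : 0 < q := hp0.trans_le hpq
  set d : ℝ := (Module.finrank ℝ E : ℝ) with hd
  -- The kernel is split as |y|^{-σ} times |x|^{-b}|y|^{σ-a}. The free exponent σ is chosen in the
  -- applications so that |y|^{-σ} is p'-integrable on the slices of S₁, and its norm times |x|^{-b}
  -- is q-integrable on those of S₂.
  set K₁ : E → E → ℝ≥0∞ := fun x y => S₁.indicator (fun z => ‖z.2‖ₑ ^ (-σ)) (x, y) with hK₁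
  set K₂ : E → E → ℝ≥0∞ := fun x y =>
    S₂.indicator (fun z => ‖z.1‖ₑ ^ (-b) * ‖z.2‖ₑ ^ (σ - a)) (x, y) with hK₂
  set A : E → ℝ≥0∞ := fun x => C₁ ^ (1 / p') * ‖x‖ₑ ^ (d / p' - σ) with hA
  have hmK₁ : Measurable (Function.uncurry K₁) :=
    (measurable_snd.enorm.pow_const _).indicator hS₁
  have hmK₂ : Measurable (Function.uncurry K₂) :=
    ((measurable_fst.enorm.pow_const _).mul (measurable_snd.enorm.pow_const _)).indicator hS₂
  have hmA : Measurable A := (measurable_enorm.pow_const _).const_mul _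
  have hC₁' : C₁ ^ (1 / p') ≠ ⊤ := ENNReal.rpow_ne_top_of_nonneg (by positivity) hC₁
  have hC₂' : C₂ ^ (1 / q) ≠ ⊤ := ENNReal.rpow_ne_top_of_nonneg (by positivity) hC₂
  refine ⟨C₁ ^ (1 / p') * C₂ ^ (1 / q), by finiteness, fun f hf => ?_⟩
  have key := lpn_kernel_le (μ := (volume : Measure E)) (ν := (volume : Measure E)) hp hpq hmK₁ hmK₂
    hmA (B := C₁ ^ (1 / p') * C₂ ^ (1 / q)) ?_ ?_ hf
  · refine le_of_eq_of_le (lpn_congr_ae (Eventually.of_forall fun x => ?_)) key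
    refine lintegral_congr_ae ?_
    filter_upwards [Measure.ae_ne volume (0 : E)] with y hy
    have hy0 : ‖y‖ₑ ≠ 0 := by simpa using hy
    simp only [hK₁, hK₂, Set.indicator_apply, Set.mem_inter_iff]
    by_cases hz₁ : (x, y) ∈ S₁ <;> by_cases hz₂ : (x, y) ∈ S₂ <;> simp only [hz₁, hz₂, and_self,
      and_true, and_false, if_true, if_false, zero_mul, mul_zero]
    rw [mul_left_comm, ← ENNReal.rpow_add _ _ hy0 (by simp)]
    ring_nf
  · filter_upwards [Measure.ae_ne volume (0 : E)] with x hx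
    have hm : MeasurableSet {y | (x, y) ∈ S₁} := measurable_prodMk_left hS₁
    have : ∫⁻ y, K₁ x y ^ p' = ∫⁻ y : E in {y | (x, y) ∈ S₁}, ‖y‖ₑ ^ (-(σ * p')) := by
      rw [← lintegral_indicator hm]
      refine lintegral_congr fun y => ?_
      simp only [hK₁, Set.indicator_apply, Set.mem_ofPred_eq]
      split_ifs
      · rw [← ENNReal.rpow_mul]; ring_nf
      · exact ENNReal.zero_rpow_of_pos hp'0
    unfold lpn
    rw [this]
    refine (ENNReal.rpow_le_rpow (h₁ x hx) (by positivity)).trans_eq ?_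
    rw [ENNReal.mul_rpow_of_nonneg _ _ (by positivity), ← ENNReal.rpow_mul, hA]
    simp only
    congr 2
    field_simp
    ring
  · filter_upwards [Measure.ae_ne volume (0 : E)] with y hy
    have hy0 : ‖y‖ₑ ≠ 0 := by simpa using hy
    have hm : MeasurableSet {x | (x, y) ∈ S₂} := measurable_prodMk_right hS₂
    have hy1 : ‖y‖ₑ ^ (σ - a) ≠ ⊤ := ENNReal.rpow_ne_top_of_ne_zero hy0 (by simp)
    have h3 : lpn volume q (fun x => A x * K₂ x y) = C₁ ^ (1 / p') * (‖y‖ₑ ^ (σ - a) *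
        lpn volume q ({x | (x, y) ∈ S₂}.indicator fun x => ‖x‖ₑ ^ (d / p' - σ - b))) := by
      rw [← lpn_const_mul hq0 hy1, ← lpn_const_mul hq0 hC₁']
      refine lpn_congr_ae ?_
      filter_upwards [Measure.ae_ne volume (0 : E)] with x hx
      have hx0 : ‖x‖ₑ ≠ 0 := by simpa using hx
      simp only [hA, hK₂, Set.indicator_apply, Set.mem_ofPred_eq]
      split_ifs
      · rw [sub_eq_add_neg _ b, ENNReal.rpow_add _ _ hx0 (by simp)]; ring
      · simp
    rw [h3]
    gcongr
    have h4 : ∫⁻ x, ({x | (x, y) ∈ S₂}.indicator (fun x => ‖x‖ₑ ^ (d / p' - σ - b)) x) ^ q =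
        ∫⁻ x : E in {x | (x, y) ∈ S₂}, ‖x‖ₑ ^ ((d / p' - σ - b) * q) := by
      rw [← lintegral_indicator hm]
      refine lintegral_congr fun x => ?_
      simp only [Set.indicator_apply]
      split_ifs
      · rw [← ENNReal.rpow_mul]
      · exact ENNReal.zero_rpow_of_pos hq0
    unfold lpn
    rw [h4]
    refine (mul_le_mul_right (ENNReal.rpow_le_rpow (h₂ y hy) (by positivity)) _).trans_eq ?_
    rw [ENNReal.mul_rpow_of_nonneg _ _ (by positivity), ← ENNReal.rpow_mul, mul_left_comm,
      ← ENNReal.rpow_add _ _ hy0 (by simp)]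
    -- Critical homogeneity: all powers of |y| cancel, so the bound is uniform in y.
    have h5 : σ - a + (d + (d / p' - σ - b) * q) * (1 / q) = 0 := by
      have : (d + (d / p' - σ - b) * q) * (1 / q) = d * (1 / p' + 1 / q) - σ - b := by
        field_simp; ring
      rw [this, ← hab]; ring
    rw [h5, ENNReal.rpow_zero, mul_one]

omit [InnerProductSpace ℝ E] [FiniteDimensional ℝ E] in
lemma measurableSet_enorm_lt : MeasurableSet {z : E × E | ‖z.2‖ₑ < ‖z.1‖ₑ} :=
  measurableSet_lt measurable_snd.enorm measurable_fst.enorm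

omit [InnerProductSpace ℝ E] [FiniteDimensional ℝ E] in
lemma measurableSet_enorm_le : MeasurableSet {z : E × E | ‖z.2‖ₑ ≤ ‖z.1‖ₑ} :=
  measurableSet_le measurable_snd.enorm measurable_fst.enorm

/-- Choose a < σ < d/p'. The upper bound makes |y|^{-σp'} integrable near 0; the lower one, through
the critical degree, makes the power of |x| integrable at infinity. -/
lemma exists_hardy_inner [Nontrivial E] {p p' q a b : ℝ} (hp : p.HolderConjugate p') (hpq : p ≤ q)
    (hab : a + b = (Module.finrank ℝ E : ℝ) * (1 / p' + 1 / q))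
    (ha : a < (Module.finrank ℝ E : ℝ) / p') :
    ∃ C : ℝ≥0∞, C ≠ ⊤ ∧ ∀ f : E → ℝ≥0∞, Measurable f →
      lpn volume q (fun x => ∫⁻ y, {z : E × E | ‖z.2‖ₑ < ‖z.1‖ₑ}.indicator
        (fun z => ‖z.1‖ₑ ^ (-b) * ‖z.2‖ₑ ^ (-a)) (x, y) * f y) ≤ C * lpn volume p f := by
  have hp'0 : 0 < p' := hp.symm.pos
  have hq0 : 0 < q := hp.pos.trans_le hpq
  obtain ⟨σ, hσ₁, hσ₂⟩ := exists_between ha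
  obtain ⟨C₁, hC₁, h₁⟩ := exists_setLIntegral_enorm_lt_le (E := E) (a := -(σ * p')) (by
    rw [lt_div_iff₀ hp'0] at hσ₂; linarith)
  obtain ⟨C₂, hC₂, h₂⟩ := exists_setLIntegral_le_enorm_le (E := E)
    (a := (Module.finrank ℝ E / p' - σ - b) * q) (by
      have h : Module.finrank ℝ E / p' - σ - b < -(Module.finrank ℝ E / q) := by
        have : (Module.finrank ℝ E : ℝ) * (1 / p' + 1 / q) =
          Module.finrank ℝ E / p' + Module.finrank ℝ E / q := by ring
        linarith
      calc _ < -(Module.finrank ℝ E / q) * q := by gcongr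
        _ = _ := by field_simp)
  obtain ⟨C, hC, h⟩ := lpn_hardy_le hp hpq hab measurableSet_enorm_lt measurableSet_enorm_le hC₁ hC₂
    (fun x hx => (h₁ ‖x‖ₑ (by simpa using hx) (by simp)).le)
    (fun x hx => (h₂ ‖x‖ₑ (by simpa using hx) (by simp)).le)
  -- The power integrals are over an open ball and over the complement of one, hence one strict and
  -- one non-strict region.
  have hS : {z : E × E | ‖z.2‖ₑ < ‖z.1‖ₑ} ∩ {z : E × E | ‖z.2‖ₑ ≤ ‖z.1‖ₑ} =
      {z : E × E | ‖z.2‖ₑ < ‖z.1‖ₑ} :=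
    Set.inter_eq_left.2 fun z (hz : ‖z.2‖ₑ < ‖z.1‖ₑ) =>
      show ‖z.2‖ₑ ≤ ‖z.1‖ₑ from hz.le
  rw [hS] at h
  exact ⟨C, hC, h⟩

lemma exists_hardy_outer [Nontrivial E] {p p' q a b : ℝ} (hp : p.HolderConjugate p') (hpq : p ≤ q)
    (hab : a + b = (Module.finrank ℝ E : ℝ) * (1 / p' + 1 / q))
    (hb : b < (Module.finrank ℝ E : ℝ) / q) :
    ∃ C : ℝ≥0∞, C ≠ ⊤ ∧ ∀ f : E → ℝ≥0∞, Measurable f →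
      lpn volume q (fun x => ∫⁻ y, {z : E × E | ‖z.1‖ₑ < ‖z.2‖ₑ}.indicator
        (fun z => ‖z.1‖ₑ ^ (-b) * ‖z.2‖ₑ ^ (-a)) (x, y) * f y) ≤ C * lpn volume p f := by
  have hp'0 : 0 < p' := hp.symm.pos
  have hq0 : 0 < q := hp.pos.trans_le hpq
  obtain ⟨τ, hτ₁, hτ₂⟩ := exists_between hb
  -- Mirror image of the inner case: τ > b gives σ > d/p', hence integrability in y at infinity,
  -- while the power of |x| is -τ > -d/q, hence integrability at the origin after raising to the
  -- power q.
  set σ := (Module.finrank ℝ E : ℝ) / p' + τ - b with hσ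
  obtain ⟨C₁, hC₁, h₁⟩ := exists_setLIntegral_le_enorm_le (E := E) (a := -(σ * p')) (by
    have : (Module.finrank ℝ E : ℝ) / p' < σ := by linarith
    rw [div_lt_iff₀ hp'0] at this; linarith)
  obtain ⟨C₂, hC₂, h₂⟩ := exists_setLIntegral_enorm_lt_le (E := E)
    (a := (Module.finrank ℝ E / p' - σ - b) * q) (by
      have h : -(Module.finrank ℝ E / q) < Module.finrank ℝ E / p' - σ - b := by
        rw [hσ]; linarith
      calc _ = -(Module.finrank ℝ E / q) * q := by field_simp
        _ < _ := by gcongr)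
  obtain ⟨C, hC, h⟩ := lpn_hardy_le hp hpq hab (measurable_swap (measurableSet_enorm_le (E := E)))
    (measurable_swap (measurableSet_enorm_lt (E := E))) hC₁ hC₂
    (fun x hx => (h₁ ‖x‖ₑ (by simpa using hx) (by simp)).le)
    (fun x hx => (h₂ ‖x‖ₑ (by simpa using hx) (by simp)).le)
  have hS : Prod.swap ⁻¹' {z : E × E | ‖z.2‖ₑ ≤ ‖z.1‖ₑ} ∩
      Prod.swap ⁻¹' {z : E × E | ‖z.2‖ₑ < ‖z.1‖ₑ} = {z : E × E | ‖z.1‖ₑ < ‖z.2‖ₑ} :=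
    Set.inter_eq_right.2 fun z (hz : ‖z.1‖ₑ < ‖z.2‖ₑ) =>
      show ‖z.1‖ₑ ≤ ‖z.2‖ₑ from hz.le
  rw [hS] at h
  exact ⟨C, hC, h⟩

/-- The diagonal part of the Stein–Weiss kernel: the part where `|x|`, `|y|` are comparable. -/
def diagRegion (E : Type*) [NormedAddCommGroup E] : Set (E × E) :=
  {z | ‖z.1‖ₑ ≤ 2 * ‖z.2‖ₑ ∧ ‖z.2‖ₑ ≤ 2 * ‖z.1‖ₑ}

omit [InnerProductSpace ℝ E] [FiniteDimensional ℝ E] in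
lemma measurableSet_diagRegion : MeasurableSet (diagRegion E) :=
  (measurableSet_le measurable_fst.enorm (measurable_snd.enorm.const_mul _)).inter
    (measurableSet_le measurable_snd.enorm (measurable_fst.enorm.const_mul _))

omit [InnerProductSpace ℝ E] [FiniteDimensional ℝ E] [MeasurableSpace E] [BorelSpace E] in
lemma enorm_sub_le_three_mul {x y : E} (h : ‖y‖ₑ ≤ 2 * ‖x‖ₑ) : ‖x - y‖ₑ ≤ 3 * ‖x‖ₑ :=
  calc ‖x - y‖ₑ ≤ ‖x‖ₑ + ‖y‖ₑ := enorm_sub_le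
    _ ≤ ‖x‖ₑ + 2 * ‖x‖ₑ := by gcongr
    _ = 3 * ‖x‖ₑ := by ring

/-- When |x| and |y| are comparable, |y|^{-α} can be replaced by |x|^{-α}, and |x - y| ≤ 3|x| with α
+ β ≥ 0 trades |x|^{-(α+β)} for |x - y|^{-(α+β)}. What remains is the Hardy–Littlewood–Sobolev
kernel. -/
lemma exists_stein_weiss_diag_of_lt [Nontrivial E] {p q α β t : ℝ} (hp : 1 < p) (hpq : p < q)
    (hαβ : 0 ≤ α + β)
    (hdeg : t + α + β = (Module.finrank ℝ E : ℝ) * (1 - 1 / p + 1 / q)) :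
    ∃ C : ℝ≥0∞, C ≠ ⊤ ∧ ∀ f : E → ℝ≥0∞, Measurable f →
      lpn volume q (fun x => ∫⁻ y, (diagRegion E).indicator
        (fun z => ‖z.1‖ₑ ^ (-β) * ‖z.1 - z.2‖ₑ ^ (-t) * ‖z.2‖ₑ ^ (-α)) (x, y) * f y) ≤
        C * lpn volume p f := by
  have hp0 : 0 < p := by linarith
  have hq0 : 0 < q := by linarith
  obtain ⟨C, hC, h⟩ := exists_hardy_littlewood_sobolev (E := E) hp hpq hdeg
  refine ⟨2 ^ |-α| * 3 ^ (α + β) * C, by finiteness, fun f hf => ?_⟩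
  have hc : (2 : ℝ≥0∞) ^ |-α| * 3 ^ (α + β) ≠ ⊤ := by finiteness
  rw [mul_assoc]
  refine le_trans ?_ (mul_le_mul_right (h f hf) _)
  rw [← lpn_const_mul hq0 hc]
  refine lpn_mono_ae hq0 ?_
  filter_upwards [Measure.ae_ne volume (0 : E)] with x hx
  rw [← lintegral_const_mul' _ _ hc]
  refine lintegral_mono_ae ?_
  filter_upwards [Measure.ae_ne volume x] with y hy
  have hx0 : ‖x‖ₑ ≠ 0 := by simpa using hx
  have hxy : ‖x - y‖ₑ ≠ 0 := by simpa [sub_eq_zero] using hy.symm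
  rw [← mul_assoc]
  refine mul_le_mul_left (Set.indicator_apply_le' (fun hz => ?_) fun _ => by positivity) _
  have h1 : ‖y‖ₑ ^ (-α) ≤ 2 ^ |-α| * ‖x‖ₑ ^ (-α) :=
    ennreal_rpow_comparable (by simp) (by simp) (by simp) hz.1 hz.2 _
  have h2 : ‖x‖ₑ ^ (-(α + β)) ≤ 3 ^ (α + β) * ‖x - y‖ₑ ^ (-(α + β)) := by
    calc ‖x‖ₑ ^ (-(α + β)) = 3 ^ (α + β) * (3 * ‖x‖ₑ) ^ (-(α + β)) := by
          rw [ENNReal.mul_rpow_of_ne_top (by simp) (by simp), ← mul_assoc,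
            ← ENNReal.rpow_add _ _ (by simp) (by simp)]
          simp
      _ ≤ _ := mul_le_mul_right
          (ennreal_rpow_anti (by linarith) (enorm_sub_le_three_mul hz.2)) _
  simp only
  calc ‖x‖ₑ ^ (-β) * ‖x - y‖ₑ ^ (-t) * ‖y‖ₑ ^ (-α)
      ≤ ‖x‖ₑ ^ (-β) * ‖x - y‖ₑ ^ (-t) * (2 ^ |-α| * ‖x‖ₑ ^ (-α)) := by gcongr
    _ = 2 ^ |-α| * ‖x - y‖ₑ ^ (-t) * ‖x‖ₑ ^ (-(α + β)) := by
        rw [neg_add, ENNReal.rpow_add _ _ hx0 (by simp)]; ring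
    _ ≤ 2 ^ |-α| * ‖x - y‖ₑ ^ (-t) * (3 ^ (α + β) * ‖x - y‖ₑ ^ (-(α + β))) := by gcongr
    _ = _ := by
        rw [show -(t + α + β) = -t + -(α + β) by ring, ENNReal.rpow_add _ _ hxy (by simp)]; ring

/-- For p = q the kernel |x - y|^{-d} would be too singular, but α + β > 0 means t < d: then
|x|^{-(α+β)}|x - y|^{-t} has, over |x - y| < 4|x|, an integral independent of x, and the Schur test
applies. -/
lemma exists_stein_weiss_diag_of_eq [Nontrivial E] {p p' α β t : ℝ} (hp : p.HolderConjugate p')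
    (hαβ : 0 < α + β) (hdeg : t + (α + β) = (Module.finrank ℝ E : ℝ)) :
    ∃ C : ℝ≥0∞, C ≠ ⊤ ∧ ∀ f : E → ℝ≥0∞, Measurable f →
      lpn volume p (fun x => ∫⁻ y, (diagRegion E).indicator
        (fun z => ‖z.1‖ₑ ^ (-β) * ‖z.1 - z.2‖ₑ ^ (-t) * ‖z.2‖ₑ ^ (-α)) (x, y) * f y) ≤
        C * lpn volume p f := by
  have hp0 : 0 < p := hp.pos
  have hp'0 : 0 < p' := hp.symm.pos
  have hinv : 1 / p + 1 / p' = 1 := by simpa using hp.inv_add_inv_eq_one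
  obtain ⟨C₀, hC₀, h₀⟩ := exists_setLIntegral_enorm_lt_le (E := E) (a := -t) (by linarith)
  -- The diagonal region only gives |x - y| ≤ 3|x|; 4 makes the inequality strict, as integration
  -- over an open ball requires.
  set g : E → E → ℝ≥0∞ := fun x z => {z : E | ‖z‖ₑ < 4 * ‖x‖ₑ}.indicator
    (fun z => ‖z‖ₑ ^ (-t) * ‖x‖ₑ ^ (-(α + β))) z with hg
  have hgm : Measurable (Function.uncurry g) := by
    have : Function.uncurry g = {z : E × E | ‖z.2‖ₑ < 4 * ‖z.1‖ₑ}.indicator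
      (fun z => ‖z.2‖ₑ ^ (-t) * ‖z.1‖ₑ ^ (-(α + β))) := rfl
    rw [this]
    exact ((measurable_snd.enorm.pow_const _).mul (measurable_fst.enorm.pow_const _)).indicator
      (measurableSet_lt measurable_snd.enorm (measurable_fst.enorm.const_mul _))
  have hgint : ∀ x : E, x ≠ 0 → ∫⁻ z, g x z = C₀ * 4 ^ (α + β) := by
    intro x hx
    have hx0 : ‖x‖ₑ ≠ 0 := by simpa using hx
    have hms : MeasurableSet {z : E | ‖z‖ₑ < 4 * ‖x‖ₑ} := measurable_enorm measurableSet_Iio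
    rw [hg, lintegral_indicator hms, lintegral_mul_const _ (measurable_enorm.pow_const _),
      h₀ _ (mul_ne_zero (by simp) hx0) (by finiteness), ← hdeg,
      show t + (α + β) + -t = α + β by ring, ENNReal.mul_rpow_of_nonneg _ _ hαβ.le,
      mul_assoc, mul_assoc, ← ENNReal.rpow_add _ _ hx0 (by simp), add_neg_cancel,
      ENNReal.rpow_zero, mul_one]
  set M : ℝ≥0∞ := C₀ * 4 ^ (α + β) with hM
  have hM' : M ≠ ⊤ := by finiteness
  -- The first factor is centred at x and the second at y, so each is integrated with the other
  -- variable fixed. Their product carries |x|^{-(α+β)/p'} |y|^{-(α+β)/p}, comparable with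
  -- |x|^{-β}|y|^{-α} on the diagonal; c is the cost.
  set K₁ : E → E → ℝ≥0∞ := fun x y => g x (x - y) ^ (1 / p') with hK₁
  set K₂ : E → E → ℝ≥0∞ := fun x y => g y (x - y) ^ (1 / p) with hK₂
  have hmK₁ : Measurable (Function.uncurry K₁) :=
    (hgm.comp (measurable_fst.prodMk (measurable_fst.sub measurable_snd))).pow_const _
  have hmK₂ : Measurable (Function.uncurry K₂) :=
    (hgm.comp (measurable_snd.prodMk (measurable_fst.sub measurable_snd))).pow_const _
  set c : ℝ≥0∞ := 2 ^ |-α + (α + β) * (1 / p)| with hc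
  have hc' : c ≠ ⊤ := by finiteness
  have hMp : M ^ (1 / p') ≠ ⊤ := ENNReal.rpow_ne_top_of_nonneg (by positivity) hM'
  have hMp' : M ^ (1 / p) ≠ ⊤ := ENNReal.rpow_ne_top_of_nonneg (by positivity) hM'
  refine ⟨c * (M ^ (1 / p') * M ^ (1 / p)), by finiteness, fun f hf => ?_⟩
  have key := lpn_kernel_le (μ := (volume : Measure E)) (ν := (volume : Measure E)) hp le_rfl hmK₁
    hmK₂ (A := fun _ => M ^ (1 / p')) measurable_const (B := M ^ (1 / p') * M ^ (1 / p)) ?_ ?_ hf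
  · rw [mul_assoc]
    refine le_trans ?_ (mul_le_mul_right key c)
    rw [← lpn_const_mul hp0 hc']
    refine lpn_mono_ae hp0 ?_
    filter_upwards [Measure.ae_ne volume (0 : E)] with x hx
    rw [← lintegral_const_mul' _ _ hc']
    refine lintegral_mono_ae ?_
    filter_upwards [Measure.ae_ne volume x, Measure.ae_ne volume (0 : E)] with y hy hy'
    have hx0 : ‖x‖ₑ ≠ 0 := by simpa using hx
    have hy0 : ‖y‖ₑ ≠ 0 := by simpa using hy'
    have hxy : ‖x - y‖ₑ ≠ 0 := by simpa [sub_eq_zero] using hy.symm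
    rw [← mul_assoc]
    refine mul_le_mul_left (Set.indicator_apply_le' (fun hz => ?_) fun _ => by positivity) _
    have h34 : ∀ z : E, ‖z‖ₑ ≠ 0 → 3 * ‖z‖ₑ < 4 * ‖z‖ₑ := fun z hz =>
      ENNReal.mul_lt_mul_left hz (by simp) (by norm_num)
    have hm₁ : ‖x - y‖ₑ < 4 * ‖x‖ₑ := (enorm_sub_le_three_mul hz.2).trans_lt (h34 x hx0)
    have hm₂ : ‖x - y‖ₑ < 4 * ‖y‖ₑ := by
      rw [enorm_sub_rev]
      exact (enorm_sub_le_three_mul hz.1).trans_lt (h34 y hy0)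
    have hK : K₁ x y * K₂ x y = ‖x - y‖ₑ ^ (-t) * ‖x‖ₑ ^ (-(α + β) * (1 / p')) *
        ‖y‖ₑ ^ (-(α + β) * (1 / p)) := by
      simp only [hK₁, hK₂, hg]
      rw [Set.indicator_of_mem (by exact hm₁), Set.indicator_of_mem (by exact hm₂),
        ENNReal.mul_rpow_of_nonneg _ _ (by positivity),
        ENNReal.mul_rpow_of_nonneg _ _ (by positivity), ← ENNReal.rpow_mul, ← ENNReal.rpow_mul,
        ← ENNReal.rpow_mul, ← ENNReal.rpow_mul]
      have : ‖x - y‖ₑ ^ (-t) = ‖x - y‖ₑ ^ (-t * (1 / p')) * ‖x - y‖ₑ ^ (-t * (1 / p)) := by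
        rw [← ENNReal.rpow_add _ _ hxy (by simp), ← mul_add, add_comm, hinv, mul_one]
      rw [this]; ring
    rw [hK]
    have h1 : ‖y‖ₑ ^ (-α + (α + β) * (1 / p)) ≤ c * ‖x‖ₑ ^ (-α + (α + β) * (1 / p)) :=
      ennreal_rpow_comparable (by simp) (by simp) (by simp) hz.1 hz.2 _
    simp only
    calc ‖x‖ₑ ^ (-β) * ‖x - y‖ₑ ^ (-t) * ‖y‖ₑ ^ (-α)
        = ‖x‖ₑ ^ (-β) * ‖x - y‖ₑ ^ (-t) * (‖y‖ₑ ^ (-α + (α + β) * (1 / p)) *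
            ‖y‖ₑ ^ (-(α + β) * (1 / p))) := by
          rw [← ENNReal.rpow_add _ _ hy0 (by simp)]; ring_nf
      _ ≤ ‖x‖ₑ ^ (-β) * ‖x - y‖ₑ ^ (-t) * (c * ‖x‖ₑ ^ (-α + (α + β) * (1 / p)) *
            ‖y‖ₑ ^ (-(α + β) * (1 / p))) := by gcongr
      _ = _ := by
          have h2 : -(α + β) * (1 / p') = -β + (-α + (α + β) * (1 / p)) := by
            linear_combination (-(α + β)) * hinv
          rw [h2, ENNReal.rpow_add (-β) _ hx0 (by simp)]; ring
  · filter_upwards [Measure.ae_ne volume (0 : E)] with x hx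
    unfold lpn
    gcongr
    simp only [hK₁, ← ENNReal.rpow_mul]
    rw [one_div_mul_cancel hp'0.ne']
    simp only [ENNReal.rpow_one]
    rw [lintegral_sub_left_eq_self (g x) x, hgint x hx]
  · filter_upwards [Measure.ae_ne volume (0 : E)] with y hy
    rw [lpn_const_mul hp0 hMp]
    gcongr
    unfold lpn
    gcongr
    simp only [hK₂, ← ENNReal.rpow_mul]
    rw [one_div_mul_cancel hp0.ne']
    simp only [ENNReal.rpow_one]
    rw [lintegral_sub_right_eq_self (g y) y, hgint y hy]

omit [InnerProductSpace ℝ E] [FiniteDimensional ℝ E] [MeasurableSpace E] [BorelSpace E] in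
lemma enorm_sub_rpow_le {x y : E} {t : ℝ} (ht : 0 ≤ t) (h : 2 * ‖y‖ₑ < ‖x‖ₑ) :
    ‖x - y‖ₑ ^ (-t) ≤ 2 ^ t * ‖x‖ₑ ^ (-t) := by
  have h1 : ‖x‖ₑ ≤ 2 * ‖x - y‖ₑ := by
    have h2 : ‖x‖ₑ ≤ ‖x - y‖ₑ + ‖y‖ₑ := by simpa using enorm_add_le (x - y) y
    have h3 : ‖x‖ₑ + ‖x‖ₑ ≤ 2 * ‖x - y‖ₑ + ‖x‖ₑ := by
      calc ‖x‖ₑ + ‖x‖ₑ ≤ (‖x - y‖ₑ + ‖y‖ₑ) + (‖x - y‖ₑ + ‖y‖ₑ) := by gcongr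
        _ = 2 * ‖x - y‖ₑ + 2 * ‖y‖ₑ := by ring
        _ ≤ _ := by gcongr
    exact (ENNReal.add_le_add_iff_right (by simp)).1 h3
  calc ‖x - y‖ₑ ^ (-t) = 2 ^ t * (2 * ‖x - y‖ₑ) ^ (-t) := by
        rw [ENNReal.mul_rpow_of_ne_top (by simp) (by simp), ← mul_assoc,
          ← ENNReal.rpow_add _ _ (by simp) (by simp)]
        simp
    _ ≤ _ := mul_le_mul_right (ennreal_rpow_anti (by linarith) h1) _

/-- The Stein–Weiss inequality. -/
theorem exists_stein_weiss [Nontrivial E] {p p' q α β t : ℝ} (hp : p.HolderConjugate p')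
    (hpq : p ≤ q) (hαβ : 0 ≤ α + β) (hα : α < (Module.finrank ℝ E : ℝ) / p')
    (hβ : β < (Module.finrank ℝ E : ℝ) / q) (htd : t < (Module.finrank ℝ E : ℝ))
    (hdeg : t + α + β = (Module.finrank ℝ E : ℝ) * (1 / p' + 1 / q)) :
    ∃ C : ℝ≥0∞, C ≠ ⊤ ∧ ∀ f : E → ℝ≥0∞, Measurable f →
      lpn volume q (fun x => ∫⁻ y, ‖x‖ₑ ^ (-β) * ‖x - y‖ₑ ^ (-t) * ‖y‖ₑ ^ (-α) * f y) ≤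
        C * lpn volume p f := by
  have hp1 : 1 < p := hp.lt
  have hq1 : 1 ≤ q := by linarith
  have hq0 : 0 < q := by linarith
  have hinv : 1 / p' = 1 - 1 / p := by
    have := hp.inv_add_inv_eq_one; simp only [one_div]; linarith
  have ht : 0 < t := by
    have : (Module.finrank ℝ E : ℝ) * (1 / p' + 1 / q) =
      Module.finrank ℝ E / p' + Module.finrank ℝ E / q := by ring
    linarith
  -- Off the diagonal |x - y| is at least half the larger of |x| and |y|, so |x - y|^{-t} is
  -- absorbed into the weight of that variable: x here, y in the next application.
  obtain ⟨C₁, hC₁, h₁⟩ := exists_hardy_inner (E := E) (a := α) (b := β + t) hp hpq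
    (by rw [← hdeg]; ring) hα
  obtain ⟨C₂, hC₂, h₂⟩ := exists_hardy_outer (E := E) (a := α + t) (b := β) hp hpq
    (by rw [← hdeg]; ring) hβ
  obtain ⟨C₃, hC₃, h₃⟩ : ∃ C : ℝ≥0∞, C ≠ ⊤ ∧ ∀ f : E → ℝ≥0∞, Measurable f →
      lpn volume q (fun x => ∫⁻ y, (diagRegion E).indicator
        (fun z => ‖z.1‖ₑ ^ (-β) * ‖z.1 - z.2‖ₑ ^ (-t) * ‖z.2‖ₑ ^ (-α)) (x, y) * f y) ≤
        C * lpn volume p f := by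
    -- For p = q the degree condition is t + α + β = d, so t < d makes α + β positive.
    rcases hpq.eq_or_lt with rfl | hlt
    · have hd : t + (α + β) = (Module.finrank ℝ E : ℝ) := by
        rw [← add_assoc, hdeg, hinv]; ring
      exact exists_stein_weiss_diag_of_eq hp (by linarith) hd
    · exact exists_stein_weiss_diag_of_lt hp1 hlt hαβ (by rw [hdeg, hinv])
  refine ⟨2 ^ t * C₁ + (2 ^ t * C₂ + C₃), by finiteness, fun f hf => ?_⟩
  have hc : (2 : ℝ≥0∞) ^ t ≠ ⊤ := by finiteness
  set k₁ : E × E → ℝ≥0∞ := {z : E × E | ‖z.2‖ₑ < ‖z.1‖ₑ}.indicator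
    (fun z => ‖z.1‖ₑ ^ (-(β + t)) * ‖z.2‖ₑ ^ (-α)) with hk₁
  set k₂ : E × E → ℝ≥0∞ := {z : E × E | ‖z.1‖ₑ < ‖z.2‖ₑ}.indicator
    (fun z => ‖z.1‖ₑ ^ (-β) * ‖z.2‖ₑ ^ (-(α + t))) with hk₂
  set k₃ : E × E → ℝ≥0∞ := (diagRegion E).indicator
    (fun z => ‖z.1‖ₑ ^ (-β) * ‖z.1 - z.2‖ₑ ^ (-t) * ‖z.2‖ₑ ^ (-α)) with hk₃
  have hm₁ : Measurable k₁ := ((measurable_fst.enorm.pow_const _).mul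
    (measurable_snd.enorm.pow_const _)).indicator measurableSet_enorm_lt
  have hm₂ : Measurable k₂ := ((measurable_fst.enorm.pow_const _).mul
    (measurable_snd.enorm.pow_const _)).indicator
      (measurable_swap (measurableSet_enorm_lt (E := E)))
  have hm₃ : Measurable k₃ := (((measurable_fst.enorm.pow_const _).mul
    ((measurable_fst.sub measurable_snd).enorm.pow_const _)).mul
    (measurable_snd.enorm.pow_const _)).indicator measurableSet_diagRegion
  have hg : ∀ {k : E × E → ℝ≥0∞}, Measurable k → Measurable fun z : E × E => k z * f z.2 :=
    fun hk => hk.mul (hf.comp measurable_snd)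
  have hT : ∀ {k : E × E → ℝ≥0∞}, Measurable k → Measurable fun x => ∫⁻ y, k (x, y) * f y :=
    fun hk => (hg hk).lintegral_prod_right'
  have hy : ∀ {k : E × E → ℝ≥0∞}, Measurable k → ∀ x, Measurable fun y => k (x, y) * f y :=
    fun hk x => (hg hk).comp (measurable_const.prodMk measurable_id)
  have hkernel : ∀ x y : E, x ≠ 0 → y ≠ 0 → ‖x‖ₑ ^ (-β) * ‖x - y‖ₑ ^ (-t) * ‖y‖ₑ ^ (-α) ≤
      2 ^ t * k₁ (x, y) + (2 ^ t * k₂ (x, y) + k₃ (x, y)) := by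
    intro x y hx hy
    have hx0 : ‖x‖ₑ ≠ 0 := by simpa using hx
    have hy0 : ‖y‖ₑ ≠ 0 := by simpa using hy
    have hle2 : ∀ z : E, ‖z‖ₑ ≤ 2 * ‖z‖ₑ := fun z => le_mul_of_one_le_left' (by norm_num)
    by_cases h1 : 2 * ‖y‖ₑ < ‖x‖ₑ
    · have hmem : (x, y) ∈ {z : E × E | ‖z.2‖ₑ < ‖z.1‖ₑ} := (hle2 y).trans_lt h1
      refine le_add_right ?_
      rw [hk₁, Set.indicator_of_mem hmem]
      simp only
      calc _ ≤ ‖x‖ₑ ^ (-β) * (2 ^ t * ‖x‖ₑ ^ (-t)) * ‖y‖ₑ ^ (-α) := by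
            gcongr; exact enorm_sub_rpow_le ht.le h1
        _ = _ := by rw [neg_add, ENNReal.rpow_add _ _ hx0 (by simp)]; ring
    by_cases h2 : 2 * ‖x‖ₑ < ‖y‖ₑ
    · have hmem : (x, y) ∈ {z : E × E | ‖z.1‖ₑ < ‖z.2‖ₑ} := (hle2 x).trans_lt h2
      refine le_add_left (le_add_right ?_)
      rw [hk₂, Set.indicator_of_mem hmem]
      simp only
      calc _ ≤ ‖x‖ₑ ^ (-β) * (2 ^ t * ‖y‖ₑ ^ (-t)) * ‖y‖ₑ ^ (-α) := by
            rw [enorm_sub_rev]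
            gcongr; exact enorm_sub_rpow_le ht.le h2
        _ = _ := by rw [neg_add, ENNReal.rpow_add _ _ hy0 (by simp)]; ring
    · refine le_add_left (le_add_left ?_)
      rw [hk₃, Set.indicator_of_mem (show (x, y) ∈ diagRegion E from ⟨not_lt.1 h1, not_lt.1 h2⟩)]
  set T₁ : E → ℝ≥0∞ := fun x => ∫⁻ y, k₁ (x, y) * f y with hT₁
  set T₂ : E → ℝ≥0∞ := fun x => ∫⁻ y, k₂ (x, y) * f y with hT₂
  set T₃ : E → ℝ≥0∞ := fun x => ∫⁻ y, k₃ (x, y) * f y with hT₃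
  have hm₁' : Measurable fun x => 2 ^ t * T₁ x := (hT hm₁).const_mul _
  have hm₂' : Measurable fun x => 2 ^ t * T₂ x := (hT hm₂).const_mul _
  calc _ ≤ lpn volume q fun x => 2 ^ t * T₁ x + (2 ^ t * T₂ x + T₃ x) := by
        refine lpn_mono_ae hq0 ?_
        filter_upwards [Measure.ae_ne volume (0 : E)] with x hx
        rw [hT₁, hT₂, hT₃]
        simp only
        rw [← lintegral_const_mul' _ _ hc, ← lintegral_const_mul' _ _ hc,
          ← lintegral_add_left ((hy hm₂ x).const_mul _), ← lintegral_add_left ((hy hm₁ x).const_mul _)]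
        refine lintegral_mono_ae ?_
        filter_upwards [Measure.ae_ne volume (0 : E)] with y hy
        rw [← mul_assoc (2 ^ t), ← mul_assoc (2 ^ t), ← add_mul, ← add_mul]
        gcongr
        exact hkernel x y hx hy
    _ ≤ 2 ^ t * lpn volume q T₁ + (2 ^ t * lpn volume q T₂ + lpn volume q T₃) := by
        refine (lpn_add_le hq1 hm₁'.aemeasurable (hm₂'.add (hT hm₃)).aemeasurable).trans ?_
        rw [lpn_const_mul hq0 hc]
        gcongr
        refine (lpn_add_le hq1 hm₂'.aemeasurable (hT hm₃).aemeasurable).trans ?_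
        rw [lpn_const_mul hq0 hc]
    _ ≤ 2 ^ t * (C₁ * lpn volume p f) + (2 ^ t * (C₂ * lpn volume p f) + C₃ * lpn volume p f) := by
        gcongr
        · exact h₁ f hf
        · exact h₂ f hf
        · exact h₃ f hf
    _ = _ := by ring

end SteinWeiss

/-! ### Stein–Weiss on a product, with a weight in the second factor only. -/

section Product

variable {E H : Type*} [NormedAddCommGroup E] [InnerProductSpace ℝ E] [FiniteDimensional ℝ E]
  [MeasurableSpace E] [BorelSpace E] [NormedAddCommGroup H] [InnerProductSpace ℝ H]
  [FiniteDimensional ℝ H] [MeasurableSpace H] [BorelSpace H]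

lemma lpn_prod {X Y : Type*} [MeasurableSpace X] [MeasurableSpace Y] {μ : Measure X} {ν : Measure Y}
    [SFinite μ] [SFinite ν] {p : ℝ} (hp : 0 < p) {f : X × Y → ℝ≥0∞} (hf : Measurable f) :
    lpn (μ.prod ν) p f = lpn ν p (fun y => lpn μ p fun x => f (x, y)) := by
  simp only [lpn, ← ENNReal.rpow_mul]
  rw [one_div_mul_cancel hp.ne', lintegral_prod_symm _ (hf.pow_const p).aemeasurable]
  simp only [ENNReal.rpow_one]

omit [InnerProductSpace ℝ E] [FiniteDimensional ℝ E] [InnerProductSpace ℝ H]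
  [FiniteDimensional ℝ H] [MeasurableSpace E] [BorelSpace E] [MeasurableSpace H] [BorelSpace H] in
lemma enorm_fst_le_prod (x : E) (z : H) : ‖x‖ₑ ≤ ‖(x, z)‖ₑ := by
  rw [← ofReal_norm, ← ofReal_norm]
  exact ENNReal.ofReal_le_ofReal (norm_fst_le (x, z))

omit [InnerProductSpace ℝ E] [FiniteDimensional ℝ E] [InnerProductSpace ℝ H]
  [FiniteDimensional ℝ H] [MeasurableSpace E] [BorelSpace E] [MeasurableSpace H] [BorelSpace H] in
lemma enorm_snd_le_prod (x : E) (z : H) : ‖z‖ₑ ≤ ‖(x, z)‖ₑ := by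
  rw [← ofReal_norm, ← ofReal_norm]
  exact ENNReal.ofReal_le_ofReal (norm_snd_le (x, z))

omit [InnerProductSpace ℝ H] [FiniteDimensional ℝ H] [MeasurableSpace H] [BorelSpace H] in
-- The sup norm of (x - y, z) dominates |x - y| and |z|, so the kernel is at most |x -
-- y|^{-s}|z|^{-t}, and Hardy–Littlewood–Sobolev acts on the first factor.
lemma exists_fiber_bound_of_lt {p q s t : ℝ} (hp : 1 < p) (hpq : p < q)
    (hs : s = (Module.finrank ℝ E : ℝ) * (1 - 1 / p + 1 / q)) (ht : 0 ≤ t) :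
    ∃ C : ℝ≥0∞, C ≠ ⊤ ∧ ∀ z : H, z ≠ 0 → ∀ f : E → ℝ≥0∞, Measurable f →
      lpn volume q (fun x => ∫⁻ y, ‖(x - y, z)‖ₑ ^ (-(s + t)) * f y) ≤
        C * ‖z‖ₑ ^ (-t) * lpn volume p f := by
  have hp0 : 0 < p := by linarith
  have hq0 : 0 < q := by linarith
  obtain ⟨C, hC, h⟩ : ∃ C : ℝ≥0∞, C ≠ ⊤ ∧ ∀ f : E → ℝ≥0∞, Measurable f →
      lpn volume q (fun x => ∫⁻ y, ‖x - y‖ₑ ^ (-s) * f y) ≤ C * lpn volume p f := by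
    -- E = 0 is the case n = 0: s = 0, and functions are constants on a point of positive finite
    -- mass.
    rcases subsingleton_or_nontrivial E with hE | hE
    · have hd : Module.finrank ℝ E = 0 := Module.finrank_zero_of_subsingleton
      have hs0 : s = 0 := by rw [hs, hd]; simp
      have : Unique E := ⟨⟨0⟩, fun x => Subsingleton.elim x 0⟩
      set c := (volume : Measure E) Set.univ with hc
      have hc0 : c ≠ 0 := isOpen_univ.measure_ne_zero _ Set.univ_nonempty
      have hc1 : c ≠ ⊤ := isCompact_univ.measure_ne_top
      refine ⟨c ^ (1 + 1 / q - 1 / p), ENNReal.rpow_ne_top_of_ne_zero hc0 hc1, fun f _ => ?_⟩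
      simp only [lpn, lintegral_unique, hs0, neg_zero, ENNReal.rpow_zero, one_mul]
      rw [← hc, ENNReal.mul_rpow_of_nonneg _ _ hq0.le,
        ENNReal.mul_rpow_of_nonneg _ _ (one_div_nonneg.2 hq0.le),
        ENNReal.mul_rpow_of_nonneg _ _ (one_div_nonneg.2 hq0.le),
        ENNReal.mul_rpow_of_nonneg _ _ (one_div_nonneg.2 hp0.le), ← ENNReal.rpow_mul,
        ← ENNReal.rpow_mul, ← ENNReal.rpow_mul, mul_one_div_cancel hp0.ne',
        mul_one_div_cancel hq0.ne', ENNReal.rpow_one, ENNReal.rpow_one, mul_comm (f default) (c ^ _),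
        mul_assoc, mul_comm (f default), ← mul_assoc,
        ← ENNReal.rpow_add _ _ hc0 hc1]
      nth_rewrite 1 [← ENNReal.rpow_one c]
      rw [← ENNReal.rpow_add _ _ hc0 hc1]
      ring_nf
      exact le_rfl
    · exact exists_hardy_littlewood_sobolev hp hpq hs
  have hs0 : 0 ≤ s := by
    rw [hs]
    have : 1 / p ≤ 1 := (div_le_one hp0).2 hp.le
    have : 0 ≤ 1 / q := by positivity
    exact mul_nonneg (by positivity) (by linarith)
  refine ⟨C, hC, fun z hz f hf => ?_⟩
  have hz0 : ‖z‖ₑ ≠ 0 := by simpa using hz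
  have hzt : ‖z‖ₑ ^ (-t) ≠ ⊤ := ENNReal.rpow_ne_top_of_ne_zero hz0 (by simp)
  calc _ ≤ lpn volume q (fun x => ‖z‖ₑ ^ (-t) * ∫⁻ y, ‖x - y‖ₑ ^ (-s) * f y) := by
        refine lpn_mono hq0 fun x => ?_
        rw [← lintegral_const_mul' _ _ hzt]
        refine lintegral_mono fun y => ?_
        rw [← mul_assoc]
        refine mul_le_mul_left ?_ _
        have h0 : ‖(x - y, z)‖ₑ ≠ 0 := fun h => hz0 (le_antisymm (h ▸ enorm_snd_le_prod _ _)
          (by positivity))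
        rw [neg_add, ENNReal.rpow_add _ _ h0 (by simp), mul_comm]
        exact mul_le_mul' (ennreal_rpow_anti (by linarith) (enorm_snd_le_prod _ _))
          (ennreal_rpow_anti (by linarith) (enorm_fst_le_prod _ _))
    _ ≤ _ := by
        rw [lpn_const_mul hq0 hzt, mul_comm C, mul_assoc]
        gcongr
        exact h f hf

omit [InnerProductSpace ℝ H] [FiniteDimensional ℝ H] [MeasurableSpace H] [BorelSpace H] in
-- Young's inequality, as Minkowski applied to translates: the kernel has L^1 norm at most C|z|^{-t}
-- in y, by comparison with (|y| + |z|)^{-(d+t)}.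
lemma exists_fiber_bound_of_eq {p t : ℝ} (hp : 1 ≤ p) (ht : 0 < t) :
    ∃ C : ℝ≥0∞, C ≠ ⊤ ∧ ∀ z : H, z ≠ 0 → ∀ f : E → ℝ≥0∞, Measurable f →
      lpn volume p (fun x => ∫⁻ y, ‖(x - y, z)‖ₑ ^ (-(Module.finrank ℝ E + t)) * f y) ≤
        C * ‖z‖ₑ ^ (-t) * lpn volume p f := by
  have hp0 : 0 < p := by linarith
  set s : ℝ := (Module.finrank ℝ E : ℝ) with hs
  have hs0 : 0 ≤ s := by positivity
  obtain ⟨C, hC, h⟩ := exists_lintegral_add_enorm_le (E := E) (a := -(s + t)) (by linarith)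
  have h2 : (2 : ℝ≥0∞) ^ (s + t) ≠ ⊤ := by finiteness
  refine ⟨2 ^ (s + t) * C, by finiteness, fun z hz f hf => ?_⟩
  have hz0 : ‖z‖ₑ ≠ 0 := by simpa using hz
  have hkm : Measurable fun y : E => ‖(y, z)‖ₑ ^ (-(s + t)) := by
    have : Continuous fun y : E => (y, z) := by fun_prop
    exact this.enorm.measurable.pow_const _
  calc lpn volume p (fun x => ∫⁻ y, ‖(x - y, z)‖ₑ ^ (-(s + t)) * f y)
      = lpn volume p (fun x => ∫⁻ y, ‖(y, z)‖ₑ ^ (-(s + t)) * f (x - y)) := by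
        congr 1 with x
        rw [← lintegral_sub_left_eq_self _ x]
        simp
    _ ≤ ∫⁻ y, lpn volume p (fun x => ‖(y, z)‖ₑ ^ (-(s + t)) * f (x - y)) := by
        refine lpn_lintegral_le hp ?_
        exact (hkm.comp measurable_snd).mul (hf.comp (measurable_fst.sub measurable_snd))
    _ = ∫⁻ y, ‖(y, z)‖ₑ ^ (-(s + t)) * lpn volume p f := by
        refine lintegral_congr fun y => ?_
        have h0 : ‖(y, z)‖ₑ ≠ 0 := fun h => hz0 (le_antisymm (h ▸ enorm_snd_le_prod _ _)
          (by positivity))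
        rw [lpn_const_mul hp0 (ENNReal.rpow_ne_top_of_ne_zero h0 (by simp))]
        congr 1
        unfold lpn
        rw [lintegral_sub_right_eq_self (fun x => f x ^ p) y]
    _ = (∫⁻ y : E, ‖(y, z)‖ₑ ^ (-(s + t))) * lpn volume p f := lintegral_mul_const _ hkm
    _ ≤ _ := by
        gcongr
        calc ∫⁻ y : E, ‖(y, z)‖ₑ ^ (-(s + t))
            ≤ ∫⁻ y : E, 2 ^ (s + t) * (‖y‖ₑ + ‖z‖ₑ) ^ (-(s + t)) := by
              refine lintegral_mono fun y => ?_
              calc ‖(y, z)‖ₑ ^ (-(s + t)) = 2 ^ (s + t) * (2 * ‖(y, z)‖ₑ) ^ (-(s + t)) := by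
                    rw [ENNReal.mul_rpow_of_ne_top (by simp) (by simp), ← mul_assoc,
                      ← ENNReal.rpow_add _ _ (by simp) (by simp)]
                    simp
                _ ≤ _ := by
                    refine mul_le_mul_right (ennreal_rpow_anti (by linarith) ?_) _
                    rw [two_mul]
                    exact add_le_add (enorm_fst_le_prod _ _) (enorm_snd_le_prod _ _)
          _ = 2 ^ (s + t) * C * ‖z‖ₑ ^ (-t) := by
              rw [lintegral_const_mul' _ _ h2, h _ hz0 (by simp), ← hs, mul_assoc,
                show s + -(s + t) = -t by ring]

/-- The Stein–Weiss inequality with a weight in the second variable only. -/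
theorem exists_stein_weiss_prod [Nontrivial H] {p p' q α β γ : ℝ} (hp : p.HolderConjugate p')
    (hpq : p ≤ q) (hαβ : 0 ≤ α + β) (hα : α < (Module.finrank ℝ H : ℝ) / p')
    (hβ : β < (Module.finrank ℝ H : ℝ) / q) (hγ : 0 < γ)
    (hdeg : 1 / q = 1 / p + (α + β - γ) / ((Module.finrank ℝ E : ℝ) + Module.finrank ℝ H)) :
    ∃ C : ℝ≥0∞, C ≠ ⊤ ∧ ∀ F : E × H → ℝ≥0∞, Measurable F →
      lpn volume q (fun X : E × H => ‖X.2‖ₑ ^ (-β) * ∫⁻ Y : E × H,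
        ‖X - Y‖ₑ ^ (-((Module.finrank ℝ E : ℝ) + Module.finrank ℝ H - γ)) * F Y) ≤
        C * lpn volume p (fun Y : E × H => ‖Y.2‖ₑ ^ α * F Y) := by
  have hp1 : 1 < p := hp.lt
  have hp0 : 0 < p := hp.pos
  have hq1 : 1 ≤ q := by linarith
  have hq0 : 0 < q := by linarith
  have hinv : 1 / p' = 1 - 1 / p := by
    have := hp.inv_add_inv_eq_one; simp only [one_div]; linarith
  set dE : ℝ := (Module.finrank ℝ E : ℝ) with hdE
  set dH : ℝ := (Module.finrank ℝ H : ℝ) with hdH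
  have hdE0 : 0 ≤ dE := by positivity
  have hdH0 : 0 < dH := by
    rw [hdH]; exact_mod_cast Module.finrank_pos (R := ℝ) (M := H)
  have hN : dE + dH ≠ 0 := by positivity
  have hdeg' : (dE + dH) * (1 / q - 1 / p) = α + β - γ := by
    rw [hdeg]; field_simp; ring
  -- t is the Stein–Weiss degree on H and s the Hardy–Littlewood–Sobolev degree on E; the scaling
  -- relation says exactly that they add up to dE + dH - γ.
  set t : ℝ := dH * (1 / p' + 1 / q) - (α + β) with ht
  set s : ℝ := dE * (1 - 1 / p + 1 / q) with hs
  have ht0 : 0 < t := by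
    have : dH * (1 / p' + 1 / q) = dH / p' + dH / q := by ring
    linarith
  have hst : dE + dH - γ = s + t := by
    rw [hs, ht, hinv]; linear_combination -hdeg'
  have hle : 1 / q ≤ 1 / p := one_div_le_one_div_of_le hp0 hpq
  -- For p = q scaling forces α + β = γ > 0; for p < q the factor 1/p' + 1/q is already below 1.
  have htd : t < dH := by
    rcases hpq.eq_or_lt with h | h
    · have h1 : 1 / q = 1 / p := by rw [h]
      rw [h1, sub_self, mul_zero] at hdeg'
      rw [ht, hinv, h1]; linarith
    · have h1 : 1 / q < 1 / p := one_div_lt_one_div_of_lt hp0 h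
      have : dH * (1 / p' + 1 / q) < dH * 1 := by
        rw [hinv]; gcongr; linarith
      linarith
  obtain ⟨C₁, hC₁, h₁⟩ : ∃ C : ℝ≥0∞, C ≠ ⊤ ∧ ∀ z : H, z ≠ 0 → ∀ f : E → ℝ≥0∞, Measurable f →
      lpn volume q (fun x => ∫⁻ y, ‖(x - y, z)‖ₑ ^ (-(s + t)) * f y) ≤
        C * ‖z‖ₑ ^ (-t) * lpn volume p f := by
    rcases hpq.eq_or_lt with rfl | h
    · have : s = dE := by rw [hs]; ring
      rw [this]
      exact exists_fiber_bound_of_eq hp1.le ht0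
    · exact exists_fiber_bound_of_lt hp1 h hs ht0.le
  obtain ⟨C₂, hC₂, h₂⟩ := exists_stein_weiss (E := H) (t := t) hp hpq hαβ hα hβ htd
    (by rw [ht]; ring)
  refine ⟨C₁ * C₂, by finiteness, fun F hF => ?_⟩
  rw [hst]
  set k : H → E × E × H → ℝ≥0∞ := fun z w => ‖(w.1 - w.2.1, z - w.2.2)‖ₑ ^ (-(s + t)) * F w.2
    with hk
  have hkm : Measurable (Function.uncurry k) := by
    refine Measurable.mul ?_ (hF.comp (measurable_snd.comp measurable_snd))
    have : Continuous fun u : H × E × E × H => (u.2.1 - u.2.2.1, u.1 - u.2.2.2) := by fun_prop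
    exact this.enorm.measurable.pow_const _
  set g : H → ℝ≥0∞ := fun w => ‖w‖ₑ ^ α * lpn volume p fun y => F (y, w) with hg
  have hgm : Measurable g := by
    refine (measurable_enorm.pow_const _).mul (Measurable.pow_const ?_ _)
    exact (hF.pow_const p).lintegral_prod_left'
  have hGm : Measurable fun X : E × H => ‖X.2‖ₑ ^ (-β) * ∫⁻ Y : E × H,
      ‖X - Y‖ₑ ^ (-(s + t)) * F Y := by
    refine (measurable_snd.enorm.pow_const _).mul ?_
    refine Measurable.lintegral_prod_right' (f := fun u : (E × H) × E × H =>
      ‖u.1 - u.2‖ₑ ^ (-(s + t)) * F u.2) ?_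
    exact ((measurable_fst.sub measurable_snd).enorm.pow_const _).mul (hF.comp measurable_snd)
  have hFm : Measurable fun Y : E × H => ‖Y.2‖ₑ ^ α * F Y :=
    (measurable_snd.enorm.pow_const _).mul hF
  have hgeq : lpn volume p (fun Y : E × H => ‖Y.2‖ₑ ^ α * F Y) = lpn volume p g := by
    refine (lpn_prod (μ := volume) (ν := volume) hp0 hFm).trans ?_
    refine lpn_congr_ae ?_
    filter_upwards [Measure.ae_ne volume (0 : H)] with w hw
    have hw0 : ‖w‖ₑ ≠ 0 := by simpa using hw
    exact lpn_const_mul hp0 (ENNReal.rpow_ne_top_of_ne_zero hw0 (by simp)) _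
  rw [hgeq, mul_assoc]
  refine le_trans ?_ (mul_le_mul_right (h₂ g hgm) C₁)
  refine (lpn_prod (μ := volume) (ν := volume) hq0 hGm).trans_le ?_
  rw [← lpn_const_mul hq0 hC₁]
  refine lpn_mono_ae hq0 ?_
  filter_upwards [Measure.ae_ne volume (0 : H)] with z hz
  have hz0 : ‖z‖ₑ ≠ 0 := by simpa using hz
  have hzβ : ‖z‖ₑ ^ (-β) ≠ ⊤ := ENNReal.rpow_ne_top_of_ne_zero hz0 (by simp)
  rw [lpn_const_mul hq0 hzβ]
  have hsplit : ∀ x : E, ∫⁻ Y : E × H, ‖(x, z) - Y‖ₑ ^ (-(s + t)) * F Y =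
      ∫⁻ w : H, ∫⁻ y : E, k z (x, y, w) := by
    intro x
    rw [Measure.volume_eq_prod, lintegral_prod_symm]
    · rfl
    · exact (hkm.comp (measurable_const.prodMk (measurable_const.prodMk measurable_id))).aemeasurable
  calc ‖z‖ₑ ^ (-β) * lpn volume q (fun x => ∫⁻ Y : E × H, ‖(x, z) - Y‖ₑ ^ (-(s + t)) * F Y)
      = ‖z‖ₑ ^ (-β) * lpn volume q (fun x => ∫⁻ w : H, ∫⁻ y : E, k z (x, y, w)) := by
        simp_rw [hsplit]
    -- Minkowski brings the L^q norm in x inside the integral over w; on each fibre the bound for z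
    -- - w applies, leaving a Stein–Weiss kernel acting on g.
    _ ≤ ‖z‖ₑ ^ (-β) * ∫⁻ w : H, lpn volume q (fun x => ∫⁻ y : E, k z (x, y, w)) := by
        gcongr
        refine lpn_lintegral_le hq1 ?_
        refine Measurable.lintegral_prod_right' (f := fun u : (E × H) × E => k z (u.1.1, u.2, u.1.2)) ?_
        exact hkm.comp (measurable_const.prodMk ((measurable_fst.comp measurable_fst).prodMk
          (measurable_snd.prodMk (measurable_snd.comp measurable_fst))))
    _ ≤ ‖z‖ₑ ^ (-β) * ∫⁻ w : H, C₁ * (‖z - w‖ₑ ^ (-t) * ‖w‖ₑ ^ (-α) * g w) := by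
        refine mul_le_mul_right (lintegral_mono_ae ?_) _
        filter_upwards [Measure.ae_ne volume (0 : H), Measure.ae_ne volume z] with w hw hwz
        have hw0 : ‖w‖ₑ ≠ 0 := by simpa using hw
        refine (h₁ (z - w) (sub_ne_zero.2 hwz.symm) (fun y => F (y, w))
          (hF.comp (measurable_id.prodMk measurable_const))).trans_eq ?_
        have : ‖w‖ₑ ^ (-α) * ‖w‖ₑ ^ α = 1 := by
          rw [← ENNReal.rpow_add _ _ hw0 (by simp)]; simp
        simp only [hg]
        calc _ = C₁ * (‖z - w‖ₑ ^ (-t) * 1 * lpn volume p fun y => F (y, w)) := by ring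
          _ = _ := by rw [← this]; ring
    _ = _ := by
        rw [lintegral_const_mul' _ _ hC₁, mul_left_comm, ← lintegral_const_mul' _ _ hzβ]
        congr 2 with w
        ring

end Product

/-! ### Transfer from the product to ℝ^{n+m}. -/

/-- The splitting of `ℝ^{n+m}` as a product. -/
def splitEquiv (n m : ℕ) :
    Space n m ≃ᵐ EuclideanSpace ℝ (Fin n) × EuclideanSpace ℝ (Fin m) :=
  (PiLp.sumPiLpEquivProdLpPiLp (𝕜 := ℝ) 2 (fun _ : Fin n ⊕ Fin m => ℝ)).toMeasurableEquiv.trans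
    (MeasurableEquiv.toLp 2 _).symm

lemma measurePreserving_splitEquiv (n m : ℕ) : MeasurePreserving (splitEquiv n m) :=
  (LinearIsometryEquiv.measurePreserving _).trans
    (WithLp.volume_preserving_symm_measurableEquiv_toLp_prod _ _)

lemma splitEquiv_snd {n m : ℕ} (X : Space n m) : (splitEquiv n m X).2 = hat X := rfl

lemma splitEquiv_sub {n m : ℕ} (X Y : Space n m) :
    splitEquiv n m (X - Y) = splitEquiv n m X - splitEquiv n m Y := rfl

lemma enorm_splitEquiv_le {n m : ℕ} (X : Space n m) : ‖splitEquiv n m X‖ₑ ≤ ‖X‖ₑ := by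
  rw [← ofReal_norm, ← ofReal_norm]
  refine ENNReal.ofReal_le_ofReal ?_
  rw [← LinearIsometryEquiv.norm_map (PiLp.sumPiLpEquivProdLpPiLp (𝕜 := ℝ) 2 (fun _ : Fin n ⊕ Fin m => ℝ)) X]
  exact max_le (WithLp.norm_fst_le _ _) (WithLp.norm_snd_le _ _)

lemma measurable_hat {n m : ℕ} : Measurable (hat : Space n m → EuclideanSpace ℝ (Fin m)) :=
  measurable_snd.comp (splitEquiv n m).measurable

/-- The Stein–Weiss inequality on `ℝ^{n+m}` with a partial weight. -/
theorem exists_stein_weiss_partial {n m : ℕ} {p q α β γ : ℝ} (hp : 1 < p) (hpq : p ≤ q)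
    (hm : 0 < m) (hαβ : 0 ≤ α + β) (hα : α < (m : ℝ) / Real.conjExponent p) (hβ : β < (m : ℝ) / q)
    (hγ : 0 < γ) (hγ' : γ < n + m) (hdeg : 1 / q = 1 / p + (α + β - γ) / ((n : ℝ) + m)) :
    ∃ C : ℝ≥0∞, C ≠ ⊤ ∧ ∀ F : Space n m → ℝ≥0∞, Measurable F →
      lpn volume q (fun X : Space n m => ‖hat X‖ₑ ^ (-β) * ∫⁻ Y : Space n m,
        ‖X - Y‖ₑ ^ (-((n : ℝ) + m - γ)) * F Y) ≤
        C * lpn volume p (fun Y : Space n m => ‖hat Y‖ₑ ^ α * F Y) := by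
  have hc : p.HolderConjugate (Real.conjExponent p) := Real.HolderConjugate.conjExponent hp
  have hq0 : 0 < q := by linarith
  have : Nonempty (Fin m) := ⟨⟨0, hm⟩⟩
  obtain ⟨C, hC, h⟩ := exists_stein_weiss_prod (E := EuclideanSpace ℝ (Fin n))
    (H := EuclideanSpace ℝ (Fin m)) hc hpq hαβ (by simpa using hα) (by simpa using hβ) hγ
    (by simpa using hdeg)
  refine ⟨C, hC, fun F hF => ?_⟩
  have hT := measurePreserving_splitEquiv n m
  set T := splitEquiv n m with hTdef
  have hFT : Measurable (F ∘ T.symm) := hF.comp T.symm.measurable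
  have key := h _ hFT
  simp only [finrank_euclideanSpace, Fintype.card_fin] at key
  have hGm : Measurable fun X : EuclideanSpace ℝ (Fin n) × EuclideanSpace ℝ (Fin m) =>
      ‖X.2‖ₑ ^ (-β) * ∫⁻ Y, ‖X - Y‖ₑ ^ (-((n : ℝ) + m - γ)) * (F ∘ T.symm) Y := by
    refine (measurable_snd.enorm.pow_const _).mul ?_
    refine Measurable.lintegral_prod_right' (f := fun u : (EuclideanSpace ℝ (Fin n) ×
      EuclideanSpace ℝ (Fin m)) × EuclideanSpace ℝ (Fin n) × EuclideanSpace ℝ (Fin m) =>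
      ‖u.1 - u.2‖ₑ ^ (-((n : ℝ) + m - γ)) * (F ∘ T.symm) u.2) ?_
    exact ((measurable_fst.sub measurable_snd).enorm.pow_const _).mul (hFT.comp measurable_snd)
  have hFm : Measurable fun Y : EuclideanSpace ℝ (Fin n) × EuclideanSpace ℝ (Fin m) =>
      ‖Y.2‖ₑ ^ α * (F ∘ T.symm) Y := (measurable_snd.enorm.pow_const α).mul hFT
  rw [← lpn_comp hT hGm, ← lpn_comp hT hFm] at key
  refine le_trans (lpn_mono hq0 fun X => ?_) (key.trans_eq ?_)
  · rw [← hT.lintegral_comp_emb T.measurableEmbedding, splitEquiv_snd]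
    refine mul_le_mul_right (lintegral_mono fun Y => ?_) _
    rw [Function.comp_apply, T.symm_apply_apply, ← splitEquiv_sub]
    -- Because γ < n + m the exponent is negative, so replacing the Euclidean norm by the smaller
    -- sup norm of the product only enlarges the kernel.
    exact mul_le_mul_left (ennreal_rpow_anti (by linarith) (enorm_splitEquiv_le _)) _
  · simp [hTdef, splitEquiv_snd]

/-! ### Domination of a function by the Riesz potential of its fractional Laplacian. -/

/-- The substitution b ↦ 1/b in the Gamma integral. It writes the inverse multiplier |ξ|^{-γ} as a
superposition of Gaussians, whose Fourier transforms are explicit. -/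
lemma integral_rpow_mul_exp_neg_div {γ r : ℝ} (hγ : 0 < γ) (hr : 0 < r) :
    IntegrableOn (fun b : ℝ => b ^ (-γ / 2 - 1) * Real.exp (-(r ^ 2 / b))) (Set.Ioi 0) ∧
      ∫ b in Set.Ioi (0 : ℝ), b ^ (-γ / 2 - 1) * Real.exp (-(r ^ 2 / b)) =
        Real.Gamma (γ / 2) * r ^ (-γ) := by
  set g : ℝ → ℝ := fun y => y ^ (γ / 2 - 1) * Real.exp (-(r ^ 2 * y)) with hg
  have hgint : ∫ y in Set.Ioi (0 : ℝ), g y = Real.Gamma (γ / 2) * r ^ (-γ) := by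
    rw [hg, Real.integral_rpow_mul_exp_neg_mul_Ioi (by positivity) (by positivity), mul_comm,
      one_div, ← Real.rpow_natCast, ← Real.rpow_neg hr.le, ← Real.rpow_mul hr.le]
    congr 2
    push_cast; ring
  have hgI : IntegrableOn g (Set.Ioi 0) := by
    refine Integrable.of_integral_ne_zero ?_
    rw [hgint]
    exact (mul_pos (Real.Gamma_pos_of_pos (by positivity)) (by positivity)).ne'
  have hcongr : ∀ x ∈ Set.Ioi (0 : ℝ), (|(-1 : ℝ)| * x ^ ((-1 : ℝ) - 1)) • g (x ^ (-1 : ℝ)) =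
      x ^ (-γ / 2 - 1) * Real.exp (-(r ^ 2 / x)) := by
    intro x (hx : 0 < x)
    simp only [hg, smul_eq_mul, abs_neg, abs_one, one_mul]
    rw [← Real.rpow_mul hx.le, ← mul_assoc, ← Real.rpow_add hx, Real.rpow_neg_one, div_eq_mul_inv]
    congr 2
    ring
  refine ⟨?_, ?_⟩
  · exact ((integrableOn_Ioi_comp_rpow_iff g (by norm_num : (-1 : ℝ) ≠ 0)).2 hgI).congr_fun hcongr
      measurableSet_Ioi
  · rw [← hgint, ← integral_comp_rpow_Ioi g (by norm_num : (-1 : ℝ) ≠ 0)]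
    exact (setIntegral_congr_fun measurableSet_Ioi hcongr).symm

lemma lintegral_rpow_mul_exp_neg_mul {a r : ℝ} (ha : 0 < a) (hr : 0 < r) :
    ∫⁻ b in Set.Ioi (0 : ℝ), ENNReal.ofReal (b ^ (a - 1) * Real.exp (-(r * b))) =
      ENNReal.ofReal (Real.Gamma a * r ^ (-a)) := by
  have h := Real.integral_rpow_mul_exp_neg_mul_Ioi ha hr
  have hpos : 0 < Real.Gamma a * r ^ (-a) :=
    mul_pos (Real.Gamma_pos_of_pos ha) (Real.rpow_pos_of_pos hr _)
  have he : (1 / r) ^ a * Real.Gamma a = Real.Gamma a * r ^ (-a) := by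
    rw [one_div, Real.inv_rpow hr.le, Real.rpow_neg hr.le, mul_comm]
  rw [← he, ← h, ofReal_integral_eq_lintegral_ofReal]
  · refine Integrable.of_integral_ne_zero ?_
    rw [h, he]
    exact hpos.ne'
  · filter_upwards [ae_restrict_mem measurableSet_Ioi] with b hb
    have : (0 : ℝ) < b := hb
    positivity

section RieszRepresentation

variable {V : Type*} [NormedAddCommGroup V] [InnerProductSpace ℝ V] [FiniteDimensional ℝ V]
  [MeasurableSpace V] [BorelSpace V]

lemma continuous_fourierInv {h : V → ℂ} (hh : Integrable h) : Continuous (𝓕⁻ h) :=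
  VectorFourier.fourierIntegral_continuous (μ := volume) (L := -innerₗ V)
    Real.continuous_fourierChar (continuous_inner.neg) hh

/-- The Fourier transform is moved from one factor to the other: H, which is h modulated by the
character at x, has transform y ↦ 𝓕⁻ h (x - y), and the Gaussian P transforms into a Gaussian. -/
lemma integral_gaussian_mul_eq {h : V → ℂ} (hh : Integrable h) {b : ℝ} (hb : 0 < b) (x : V) :
    ∫ ξ, (Real.exp (-(Real.pi ^ 2 * ‖ξ‖ ^ 2 / b)) : ℂ) * (𝐞 (inner ℝ ξ x) • h ξ) =
      (((b / Real.pi) ^ ((Module.finrank ℝ V : ℝ) / 2) : ℝ) : ℂ) *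
        ∫ y, (Real.exp (-(b * ‖y‖ ^ 2)) : ℂ) * 𝓕⁻ h (x - y) := by
  set H : V → ℂ := fun ξ => 𝐞 (inner ℝ ξ x) • h ξ with hH
  set P : V → ℂ := fun v => Complex.exp (-(b : ℂ) * ‖v‖ ^ 2) with hP
  have hbre : 0 < (b : ℂ).re := by simpa using hb
  have hPint : Integrable P := by
    simpa [hP] using GaussianFourier.integrable_cexp_neg_mul_sq_norm_add hbre 0 (0 : V)
  have hHint : Integrable H := by
    have B : Continuous fun p : V × V => (- innerₗ V) p.1 p.2 := continuous_inner.neg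
    simpa using!
      (VectorFourier.fourierIntegral_convergent_iff Real.continuous_fourierChar B x).2 hh
  have hFH : ∀ y, 𝓕 H y = 𝓕⁻ h (x - y) := by
    intro y
    rw [Real.fourier_eq, Real.fourierInv_eq]
    refine integral_congr_ae (Eventually.of_forall fun ξ => ?_)
    simp only [hH]
    rw [smul_smul, ← AddChar.map_add_eq_mul, inner_sub_right]
    congr 2
    ring
  have hflip : ∫ y, 𝓕 H y * P y = ∫ ξ, H ξ * 𝓕 P ξ := by
    simpa using! VectorFourier.integral_fourierIntegral_smul_eq_flip (L := innerₗ V)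
      Real.continuous_fourierChar continuous_inner hHint hPint
  have hFP : ∀ ξ, 𝓕 P ξ = (((Real.pi / b) ^ ((Module.finrank ℝ V : ℝ) / 2) : ℝ) : ℂ) *
      (Real.exp (-(Real.pi ^ 2 * ‖ξ‖ ^ 2 / b)) : ℂ) := by
    intro ξ
    rw [hP, fourier_gaussian_innerProductSpace hbre]
    congr 1
    · rw [Complex.ofReal_cpow (by positivity)]
      push_cast
      rfl
    · push_cast
      congr 1
      ring
  have hc : (((b / Real.pi) ^ ((Module.finrank ℝ V : ℝ) / 2) : ℝ) : ℂ) *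
      (((Real.pi / b) ^ ((Module.finrank ℝ V : ℝ) / 2) : ℝ) : ℂ) = 1 := by
    rw [← Complex.ofReal_mul, ← Real.mul_rpow (by positivity) (by positivity)]
    have : b / Real.pi * (Real.pi / b) = 1 := by
      have := Real.pi_pos.ne'
      field_simp
    rw [this]; simp
  calc ∫ ξ, (Real.exp (-(Real.pi ^ 2 * ‖ξ‖ ^ 2 / b)) : ℂ) * H ξ
      = (((b / Real.pi) ^ ((Module.finrank ℝ V : ℝ) / 2) : ℝ) : ℂ) * ∫ ξ, H ξ * 𝓕 P ξ := by
        rw [← integral_const_mul]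
        refine integral_congr_ae (Eventually.of_forall fun ξ => ?_)
        simp only [hFP]
        linear_combination (-(Real.exp (-(Real.pi ^ 2 * ‖ξ‖ ^ 2 / b)) : ℂ) * H ξ) * hc
    _ = _ := by
        rw [← hflip]
        congr 1
        refine integral_congr_ae (Eventually.of_forall fun y => ?_)
        simp only [hFH, hP, mul_comm]
        push_cast
        ring_nf

/-- A function is dominated by the Riesz potential of its fractional Laplacian. -/
theorem exists_enorm_le_riesz_potential {γ : ℝ} (hγ : 0 < γ) (hγ' : γ < Module.finrank ℝ V) :
    ∃ C : ℝ≥0∞, C ≠ ⊤ ∧ ∀ ψ h : V → ℂ, Continuous ψ → Integrable ψ → Integrable h →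
      (∀ ξ, h ξ = (((2 * Real.pi * ‖ξ‖) ^ γ : ℝ) : ℂ) * ψ ξ) → ∀ x : V,
        ‖(𝓕⁻ ψ x).re‖ₑ ≤
          C * ∫⁻ y, ‖x - y‖ₑ ^ (-(Module.finrank ℝ V - γ)) * ‖(𝓕⁻ h y).re‖ₑ := by
  set d : ℝ := (Module.finrank ℝ V : ℝ) with hd
  have hVn : Nontrivial V := by
    refine Module.nontrivial_of_finrank_pos (R := ℝ) ?_
    have : 0 < d := hγ.trans hγ'
    rw [hd] at this
    exact_mod_cast this
  have hπ := Real.pi_pos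
  have hΓ : 0 < Real.Gamma (γ / 2) := Real.Gamma_pos_of_pos (by positivity)
  -- c₀ is Γ(γ/2)(π|ξ|)^{-γ} times the symbol (2π|ξ|)^γ. c₁ collects the Gamma factor of the
  -- integral in b on the physical side and the π^{-d/2} of the Gaussian.
  set c₀ : ℝ := Real.Gamma (γ / 2) * 2 ^ γ with hc₀
  have hc₀pos : 0 < c₀ := by positivity
  set c₁ : ℝ := Real.Gamma ((d - γ) / 2) * Real.pi ^ (-(d / 2)) with hc₁
  refine ⟨(ENNReal.ofReal c₀)⁻¹ * ENNReal.ofReal c₁, ?_, ?_⟩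
  · have : (ENNReal.ofReal c₀)⁻¹ ≠ ⊤ := by simpa using hc₀pos
    finiteness
  intro ψ h hψ hψi hhi hrel x
  have hh : Continuous h := by
    have : h = fun ξ => (((2 * Real.pi * ‖ξ‖) ^ γ : ℝ) : ℂ) * ψ ξ := funext hrel
    rw [this]
    refine Continuous.mul (Complex.continuous_ofReal.comp ?_) hψ
    exact (by fun_prop : Continuous fun ξ : V => 2 * Real.pi * ‖ξ‖).rpow_const
      fun _ => Or.inr hγ.le
  set κ : ℝ → V → ℝ := fun b ξ => b ^ (-γ / 2 - 1) * Real.exp (-((Real.pi * ‖ξ‖) ^ 2 / b)) with hκ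
  have hκm : Measurable (Function.uncurry κ) := by
    have : Function.uncurry κ = fun z : ℝ × V => z.1 ^ (-γ / 2 - 1) *
      Real.exp (-((Real.pi * ‖z.2‖) ^ 2 / z.1)) := rfl
    rw [this]
    fun_prop
  set Φ : V → ℂ := fun ξ => 𝐞 (inner ℝ ξ x) • h ξ with hΦ
  have hΦc : Continuous Φ := by
    have hin : Continuous fun ξ : V => inner ℝ ξ x := by fun_prop
    exact (Real.continuous_fourierChar.comp hin).smul hh
  have hΦn : ∀ ξ, ‖Φ ξ‖ = ‖h ξ‖ := fun ξ => Circle.norm_smul _ _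
  have hκint : ∀ ξ : V, ξ ≠ 0 → IntegrableOn (fun b => κ b ξ) (Set.Ioi 0) ∧
      ∫ b in Set.Ioi (0 : ℝ), κ b ξ = Real.Gamma (γ / 2) * (Real.pi * ‖ξ‖) ^ (-γ) := fun ξ hξ =>
    integral_rpow_mul_exp_neg_div hγ (mul_pos hπ (norm_pos_iff.2 hξ))
  have hκh : ∀ ξ : V, ξ ≠ 0 → ((Real.Gamma (γ / 2) * (Real.pi * ‖ξ‖) ^ (-γ) : ℝ) : ℂ) * h ξ =
      (c₀ : ℂ) * ψ ξ := by
    intro ξ hξ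
    have hpos : 0 < Real.pi * ‖ξ‖ := mul_pos hπ (norm_pos_iff.2 hξ)
    rw [hrel, ← mul_assoc, ← Complex.ofReal_mul]
    congr 2
    rw [hc₀, mul_assoc 2, Real.mul_rpow zero_le_two hpos.le, Real.rpow_neg hpos.le]
    have := (Real.rpow_pos_of_pos hpos γ).ne'
    field_simp
  -- Integrating |κ h| in b gives exactly c₀|ψ|, so Fubini needs only the integrability of ψ.
  have hprod : Integrable (Function.uncurry fun (b : ℝ) (ξ : V) => (κ b ξ : ℂ) * Φ ξ)
      ((volume.restrict (Set.Ioi (0 : ℝ))).prod volume) := by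
    have hm : AEStronglyMeasurable (Function.uncurry fun (b : ℝ) (ξ : V) => (κ b ξ : ℂ) * Φ ξ)
        ((volume.restrict (Set.Ioi (0 : ℝ))).prod volume) :=
      ((Complex.measurable_ofReal.comp hκm).mul (hΦc.measurable.comp
        measurable_snd)).aestronglyMeasurable
    refine (integrable_prod_iff' hm).2 ⟨?_, ?_⟩
    · filter_upwards [Measure.ae_ne volume (0 : V)] with ξ hξ
      exact ((hκint ξ hξ).1.ofReal (𝕜 := ℂ)).mul_const (Φ ξ)
    · refine (hψi.norm.const_mul c₀).congr ?_
      filter_upwards [Measure.ae_ne volume (0 : V)] with ξ hξ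
      have hpos : 0 < Real.pi * ‖ξ‖ := mul_pos hπ (norm_pos_iff.2 hξ)
      have h1 := congrArg norm (hκh ξ hξ)
      rw [norm_mul, norm_mul, Complex.norm_real, Complex.norm_real, Real.norm_of_nonneg
        (by positivity), Real.norm_of_nonneg hc₀pos.le] at h1
      rw [← h1, ← (hκint ξ hξ).2, ← integral_mul_const]
      refine setIntegral_congr_fun measurableSet_Ioi fun b (hb : 0 < b) => ?_
      simp only [Function.uncurry_apply_pair, norm_mul, hΦn, Complex.norm_real]
      rw [Real.norm_of_nonneg]
      positivity
  set J : ℝ → ℂ := fun b => ∫ ξ, (κ b ξ : ℂ) * Φ ξ with hJ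
  have hJint : Integrable J (volume.restrict (Set.Ioi (0 : ℝ))) := hprod.integral_prod_left
  have hJval : ∫ b in Set.Ioi (0 : ℝ), J b = (c₀ : ℂ) * 𝓕⁻ ψ x := by
    rw [hJ, integral_integral_swap hprod, Real.fourierInv_eq, ← integral_const_mul]
    refine integral_congr_ae ?_
    filter_upwards [Measure.ae_ne volume (0 : V)] with ξ hξ
    have hof : ∫ b in Set.Ioi (0 : ℝ), (κ b ξ : ℂ) = ((∫ b in Set.Ioi (0 : ℝ), κ b ξ : ℝ) : ℂ) :=
      integral_ofReal
    rw [integral_mul_const, hof, (hκint ξ hξ).2, hΦ]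
    simp only
    rw [mul_smul_comm, mul_smul_comm, hκh ξ hξ]
  -- For each b, J b is an exact Gaussian average of 𝓕⁻ h. The Gaussian is real, so real parts pass
  -- through before absolute values are taken. From then on Tonelli suffices, and the Riesz
  -- potential need not converge.
  have hJre : ∀ b : ℝ, 0 < b → ‖(J b).re‖ₑ ≤ ∫⁻ y, ‖(𝓕⁻ h (x - y)).re‖ₑ *
      (ENNReal.ofReal (Real.pi ^ (-(d / 2))) *
        ENNReal.ofReal (b ^ ((d - γ) / 2 - 1) * Real.exp (-(‖y‖ ^ 2 * b)))) := by
    intro b hb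
    have h1 : J b = ((b ^ (-γ / 2 - 1) * (b / Real.pi) ^ (d / 2) : ℝ) : ℂ) *
        ∫ y, (Real.exp (-(b * ‖y‖ ^ 2)) : ℂ) * 𝓕⁻ h (x - y) := by
      rw [Complex.ofReal_mul, mul_assoc, ← integral_gaussian_mul_eq hhi hb x, ← integral_const_mul]
      refine integral_congr_ae (Eventually.of_forall fun ξ => ?_)
      simp only [hκ, hΦ]
      rw [Complex.ofReal_mul, mul_assoc, mul_pow]
    have h2 : b ^ (-γ / 2 - 1) * (b / Real.pi) ^ (d / 2) =
        Real.pi ^ (-(d / 2)) * b ^ ((d - γ) / 2 - 1) := by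
      rw [Real.div_rpow hb.le hπ.le, Real.rpow_neg hπ.le, ← mul_div_assoc, ← Real.rpow_add hb,
        div_eq_inv_mul]
      congr 2
      ring
    have hfi : Integrable fun y => (Real.exp (-(b * ‖y‖ ^ 2)) : ℂ) * 𝓕⁻ h (x - y) := by
      have hg : Integrable fun y : V => (Real.exp (-(b * ‖y‖ ^ 2)) : ℂ) := by
        have := GaussianFourier.integrable_cexp_neg_mul_sq_norm_add
          (show 0 < (b : ℂ).re by simpa using hb) 0 (0 : V)
        simpa using this
      have hcont : Continuous (𝓕⁻ h) := continuous_fourierInv hhi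
      refine hg.mul_bdd (c := ∫ ξ, ‖h ξ‖) (by fun_prop) (Eventually.of_forall fun y => ?_)
      rw [Real.fourierInv_eq]
      refine (norm_integral_le_integral_norm _).trans_eq ?_
      simp
    rw [h1, Complex.re_ofReal_mul]
    have h3 : (∫ y, (Real.exp (-(b * ‖y‖ ^ 2)) : ℂ) * 𝓕⁻ h (x - y)).re =
        ∫ y, Real.exp (-(b * ‖y‖ ^ 2)) * (𝓕⁻ h (x - y)).re := by
      rw [← RCLike.re_eq_complex_re, ← integral_re hfi]
      refine integral_congr_ae (Eventually.of_forall fun y => ?_)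
      simp only [RCLike.re_eq_complex_re]
      rw [Complex.re_ofReal_mul]
    rw [h3, h2, enorm_mul, Real.enorm_of_nonneg (by positivity)]
    refine (mul_le_mul_right (enorm_integral_le_lintegral_enorm _) _).trans_eq ?_
    rw [← lintegral_const_mul' _ _ (by simp)]
    refine lintegral_congr fun y => ?_
    rw [enorm_mul, Real.enorm_of_nonneg (Real.exp_pos _).le, ENNReal.ofReal_mul (by positivity),
      ENNReal.ofReal_mul (by positivity), mul_comm (‖y‖ ^ 2)]
    ring
  have hfm : Measurable fun y => ‖(𝓕⁻ h (x - y)).re‖ₑ := by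
    have hcont : Continuous (𝓕⁻ h) := continuous_fourierInv hhi
    exact (Complex.continuous_re.comp (hcont.comp (by fun_prop))).enorm.measurable
  have hc₀e : ENNReal.ofReal c₀ ≠ 0 := by simpa using hc₀pos
  rw [mul_assoc, ← ENNReal.mul_le_iff_le_inv hc₀e (by simp)]
  calc ENNReal.ofReal c₀ * ‖(𝓕⁻ ψ x).re‖ₑ = ‖∫ b in Set.Ioi (0 : ℝ), (J b).re‖ₑ := by
        rw [show ∫ b in Set.Ioi (0 : ℝ), (J b).re = (∫ b in Set.Ioi (0 : ℝ), J b).re from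
          integral_re hJint, hJval, Complex.re_ofReal_mul, enorm_mul,
          Real.enorm_of_nonneg hc₀pos.le]
    _ ≤ ∫⁻ b in Set.Ioi (0 : ℝ), ‖(J b).re‖ₑ := enorm_integral_le_lintegral_enorm _
    _ ≤ ∫⁻ b in Set.Ioi (0 : ℝ), ∫⁻ y, ‖(𝓕⁻ h (x - y)).re‖ₑ *
          (ENNReal.ofReal (Real.pi ^ (-(d / 2))) *
            ENNReal.ofReal (b ^ ((d - γ) / 2 - 1) * Real.exp (-(‖y‖ ^ 2 * b)))) :=
        setLIntegral_mono' measurableSet_Ioi fun b hb => hJre b hb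
    _ = ∫⁻ y, ∫⁻ b in Set.Ioi (0 : ℝ), ‖(𝓕⁻ h (x - y)).re‖ₑ *
          (ENNReal.ofReal (Real.pi ^ (-(d / 2))) *
            ENNReal.ofReal (b ^ ((d - γ) / 2 - 1) * Real.exp (-(‖y‖ ^ 2 * b)))) := by
        refine lintegral_lintegral_swap (Measurable.aemeasurable ?_)
        refine (hfm.comp measurable_snd).mul (Measurable.const_mul (ENNReal.measurable_ofReal.comp
          ?_) _)
        fun_prop
    _ = ∫⁻ y, ENNReal.ofReal c₁ * (‖y‖ₑ ^ (-(d - γ)) * ‖(𝓕⁻ h (x - y)).re‖ₑ) := by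
        refine lintegral_congr_ae ?_
        filter_upwards [Measure.ae_ne volume (0 : V)] with y hy
        have hy0 : 0 < ‖y‖ := norm_pos_iff.2 hy
        rw [lintegral_const_mul' _ _ (by simp), lintegral_const_mul' _ _ (by simp),
          lintegral_rpow_mul_exp_neg_mul (by linarith) (by positivity),
          ← ofReal_norm y, ENNReal.ofReal_rpow_of_pos hy0, hc₁,
          ENNReal.ofReal_mul (Real.Gamma_pos_of_pos (by linarith)).le,
          ENNReal.ofReal_mul (Real.Gamma_pos_of_pos (by linarith)).le,
          ← Real.rpow_natCast ‖y‖ 2, ← Real.rpow_mul hy0.le]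
        have : ((2 : ℕ) : ℝ) * -((d - γ) / 2) = -(d - γ) := by push_cast; ring
        rw [this]
        ring
    _ = _ := by
        rw [lintegral_const_mul' _ _ (by simp), ← lintegral_sub_left_eq_self _ x]
        simp

end RieszRepresentation

/-! ### Domination of a function by the Riesz potential of its gradient. -/

section GradientRepresentation

variable {V : Type*} [NormedAddCommGroup V] [InnerProductSpace ℝ V] [FiniteDimensional ℝ V]
  [MeasurableSpace V] [BorelSpace V]

omit [FiniteDimensional ℝ V] [MeasurableSpace V] [BorelSpace V] in
-- The fundamental theorem of calculus along the ray from x in the direction w; compact support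
-- removes the endpoint at infinity.
lemma enorm_le_lintegral_ray {φ : V → ℝ} (hφ : ContDiff ℝ 1 φ) (hs : HasCompactSupport φ) (x : V)
    {w : V} (hw : w ≠ 0) :
    ‖φ x‖ₑ ≤ ∫⁻ t in Set.Ioi (0 : ℝ), ‖fderiv ℝ φ (x + t • w)‖ₑ * ‖w‖ₑ := by
  set f : ℝ → ℝ := fun t => φ (x + t • w) with hf
  have hline : Topology.IsClosedEmbedding fun t : ℝ => x + t • w :=
    (Homeomorph.addLeft x).isClosedEmbedding.comp (isClosedEmbedding_smul_left hw)
  have hfs : HasCompactSupport f := hs.comp_isClosedEmbedding hline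
  have hfd : ∀ t, HasDerivAt f (fderiv ℝ φ (x + t • w) w) t := by
    intro t
    have h1 : HasDerivAt (fun t : ℝ => x + t • w) w t := by
      simpa using ((hasDerivAt_id t).smul_const w).const_add x
    exact ((hφ.differentiable one_ne_zero _).hasFDerivAt).comp_hasDerivAt t h1
  have hd : deriv f = fun t => fderiv ℝ φ (x + t • w) w := funext fun t => (hfd t).deriv
  have hfc : ContDiff ℝ 1 f := hφ.comp (by fun_prop)
  have h := hfs.integral_Ioi_deriv_eq hfc 0
  have hx : f 0 = φ x := by simp [hf]
  calc ‖φ x‖ₑ = ‖∫ t in Set.Ioi (0 : ℝ), deriv f t‖ₑ := by rw [h, enorm_neg, hx]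
    _ ≤ ∫⁻ t in Set.Ioi (0 : ℝ), ‖deriv f t‖ₑ := enorm_integral_le_lintegral_enorm _
    _ ≤ _ := by
      refine lintegral_mono fun t => ?_
      rw [hd]
      exact ContinuousLinearMap.le_opENorm _ _

/-- A function is dominated by the Riesz potential of its gradient. -/
theorem exists_enorm_le_riesz_potential_fderiv [Nontrivial V] :
    ∃ C : ℝ≥0∞, C ≠ ⊤ ∧ ∀ φ : V → ℝ, ContDiff ℝ 1 φ → HasCompactSupport φ → ∀ x : V,
      ‖φ x‖ₑ ≤ C * ∫⁻ y, ‖x - y‖ₑ ^ (-((Module.finrank ℝ V : ℝ) - 1)) * ‖fderiv ℝ φ y‖ₑ := by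
  classical
  set d : ℝ := (Module.finrank ℝ V : ℝ) with hd
  have hd0 : 0 ≤ d := by positivity
  -- Averaging the rays over a shell instead of a sphere replaces polar coordinates by the linear
  -- substitution y = t w.
  set A : Set V := {w | 1 < ‖w‖ ∧ ‖w‖ < 2} with hA
  have hAo : IsOpen A := (isOpen_lt continuous_const continuous_norm).inter
    (isOpen_lt continuous_norm continuous_const)
  have hAm : MeasurableSet A := hAo.measurableSet
  have hA0 : volume A ≠ 0 := by
    obtain ⟨v, hv⟩ := exists_norm_eq V (show (0 : ℝ) ≤ 3 / 2 by norm_num)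
    exact hAo.measure_ne_zero _ ⟨v, by simp only [hA, Set.mem_ofPred_eq, hv]; norm_num⟩
  have hA1 : volume A ≠ ⊤ := by
    refine ne_top_of_le_ne_top (measure_ball_lt_top (μ := volume) (x := (0 : V)) (r := 2)).ne
      (measure_mono fun w hw => ?_)
    simpa using hw.2
  refine ⟨(volume A)⁻¹ * (2 ^ d * 2), ?_, fun φ hφ hs x => ?_⟩
  · have : (volume A)⁻¹ ≠ ⊤ := by simpa using hA0
    finiteness
  set g : V → ℝ≥0∞ := fun y => ‖fderiv ℝ φ y‖ₑ with hg
  have hgm : Measurable g := (hφ.continuous_fderiv one_ne_zero).enorm.measurable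
  -- The Jacobian is t^{-d}. On the shell |y|/2 < t < |y|, so it is at most 2^d |y|^{-d}; the other
  -- factor 2 bounds |w|. Integrating next over this interval of t gains one power of |y|.
  have hray : ∀ t ∈ Set.Ioi (0 : ℝ), ∫⁻ w in A, g (x + t • w) * ‖w‖ₑ ≤
      ∫⁻ y, (if ‖y‖ / 2 < t ∧ t < ‖y‖ then 2 ^ d * 2 * ‖y‖ₑ ^ (-d) else 0) * g (x + y) := by
    intro t (ht : 0 < t)
    have htr : ENNReal.ofReal t ≠ 0 := by simpa using ht
    set F : V → ℝ≥0∞ := fun y => (if t⁻¹ • y ∈ A then g (x + y) * ‖t⁻¹ • y‖ₑ else 0) with hF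
    have h1 : ∫⁻ w in A, g (x + t • w) * ‖w‖ₑ = ∫⁻ w, F (t • w) := by
      rw [← lintegral_indicator hAm]
      refine lintegral_congr fun w => ?_
      rw [Set.indicator_apply]
      simp only [hF]
      rw [inv_smul_smul₀ ht.ne']
    have h2 : ∫⁻ w, F (t • w) = ENNReal.ofReal t ^ (-d) * ∫⁻ y, F y := by
      rw [lintegral_comp_smul ht F, ← mul_assoc, ← ENNReal.rpow_add _ _ htr (by simp), ← hd]
      simp
    rw [h1, h2, ← lintegral_const_mul' _ _ (ENNReal.rpow_ne_top_of_ne_zero htr (by simp))]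
    refine lintegral_mono fun y => ?_
    simp only [hF]
    by_cases hy : t⁻¹ • y ∈ A
    · have hn : ‖t⁻¹ • y‖ = ‖y‖ / t := by
        rw [norm_smul, norm_inv, Real.norm_of_nonneg ht.le, div_eq_inv_mul]
      have hy1 : 1 < ‖y‖ / t := hn ▸ hy.1
      have hy2 : ‖y‖ / t < 2 := hn ▸ hy.2
      rw [one_lt_div ht] at hy1
      have hy3 : ‖y‖ / 2 < t := by rw [div_lt_iff₀ ht] at hy2; linarith
      rw [if_pos hy, if_pos ⟨hy3, hy1⟩]
      have hb1 : ‖t⁻¹ • y‖ₑ ≤ 2 := by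
        rw [← ofReal_norm]
        exact (ENNReal.ofReal_le_ofReal hy.2.le).trans (by simp)
      have hb2 : ENNReal.ofReal t ^ (-d) ≤ 2 ^ d * ‖y‖ₑ ^ (-d) := by
        calc ENNReal.ofReal t ^ (-d) = 2 ^ d * (2 * ENNReal.ofReal t) ^ (-d) := by
              rw [ENNReal.mul_rpow_of_ne_top (by simp) (by simp), ← mul_assoc,
                ← ENNReal.rpow_add _ _ (by simp) (by simp)]
              simp
          _ ≤ _ := by
              refine mul_le_mul_right (ennreal_rpow_anti (by linarith) ?_) _
              rw [← ofReal_norm, show (2 : ℝ≥0∞) = ENNReal.ofReal 2 by simp,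
                ← ENNReal.ofReal_mul zero_le_two]
              exact ENNReal.ofReal_le_ofReal (by linarith)
      calc ENNReal.ofReal t ^ (-d) * (g (x + y) * ‖t⁻¹ • y‖ₑ)
          ≤ 2 ^ d * ‖y‖ₑ ^ (-d) * (g (x + y) * 2) := by gcongr
        _ = _ := by ring
    · rw [if_neg hy, mul_zero]
      positivity
  have hlen : ∀ y : V, y ≠ 0 → ∫⁻ t in Set.Ioi (0 : ℝ),
      (if ‖y‖ / 2 < t ∧ t < ‖y‖ then 2 ^ d * 2 * ‖y‖ₑ ^ (-d) else 0) ≤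
      2 ^ d * 2 * ‖y‖ₑ ^ (-(d - 1)) := by
    intro y hy
    have hy0 : ‖y‖ₑ ≠ 0 := by simpa using hy
    calc _ ≤ ∫⁻ t, (Set.Ioo (‖y‖ / 2) ‖y‖).indicator (fun _ => 2 ^ d * 2 * ‖y‖ₑ ^ (-d)) t := by
          refine (setLIntegral_le_lintegral _ _).trans_eq ?_
          refine lintegral_congr fun t => ?_
          simp [Set.indicator_apply]
      _ = 2 ^ d * 2 * ‖y‖ₑ ^ (-d) * ENNReal.ofReal (‖y‖ - ‖y‖ / 2) := by
          rw [lintegral_indicator_const measurableSet_Ioo, Real.volume_Ioo]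
      _ ≤ 2 ^ d * 2 * ‖y‖ₑ ^ (-d) * ‖y‖ₑ := by
          gcongr
          rw [← ofReal_norm]
          exact ENNReal.ofReal_le_ofReal (by linarith [norm_nonneg y])
      _ = _ := by
          nth_rewrite 2 [← ENNReal.rpow_one ‖y‖ₑ]
          rw [mul_assoc, ← ENNReal.rpow_add _ _ hy0 (by simp)]
          ring_nf
  have hAvg : volume A * ‖φ x‖ₑ ≤ ∫⁻ w in A, ∫⁻ t in Set.Ioi (0 : ℝ), g (x + t • w) * ‖w‖ₑ := by
    rw [mul_comm, ← setLIntegral_const]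
    refine setLIntegral_mono' hAm fun w hw => enorm_le_lintegral_ray hφ hs x ?_
    rintro rfl
    have := hw.1
    simp at this
    linarith
  rw [mul_assoc, ← ENNReal.mul_le_iff_le_inv hA0 hA1]
  have hm1 : Measurable (Function.uncurry fun (w : V) (t : ℝ) => g (x + t • w) * ‖w‖ₑ) := by
    refine (hgm.comp ?_).mul measurable_fst.enorm
    fun_prop
  have hm2 : Measurable (Function.uncurry fun (t : ℝ) (y : V) =>
      (if ‖y‖ / 2 < t ∧ t < ‖y‖ then 2 ^ d * 2 * ‖y‖ₑ ^ (-d) else 0) * g (x + y)) := by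
    refine Measurable.mul (Measurable.ite ?_ ?_ measurable_const) (hgm.comp (by fun_prop))
    · exact (measurableSet_lt (measurable_snd.norm.div_const 2) measurable_fst).inter
        (measurableSet_lt measurable_fst measurable_snd.norm)
    · exact (measurable_snd.enorm.pow_const _).const_mul _
  calc volume A * ‖φ x‖ₑ ≤ ∫⁻ w in A, ∫⁻ t in Set.Ioi (0 : ℝ), g (x + t • w) * ‖w‖ₑ := hAvg
    _ = ∫⁻ t in Set.Ioi (0 : ℝ), ∫⁻ w in A, g (x + t • w) * ‖w‖ₑ :=
        lintegral_lintegral_swap hm1.aemeasurable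
    _ ≤ ∫⁻ t in Set.Ioi (0 : ℝ), ∫⁻ y,
          (if ‖y‖ / 2 < t ∧ t < ‖y‖ then 2 ^ d * 2 * ‖y‖ₑ ^ (-d) else 0) * g (x + y) :=
        setLIntegral_mono' measurableSet_Ioi hray
    _ = ∫⁻ y, ∫⁻ t in Set.Ioi (0 : ℝ),
          (if ‖y‖ / 2 < t ∧ t < ‖y‖ then 2 ^ d * 2 * ‖y‖ₑ ^ (-d) else 0) * g (x + y) :=
        lintegral_lintegral_swap hm2.aemeasurable
    _ ≤ ∫⁻ y, 2 ^ d * 2 * (‖y‖ₑ ^ (-(d - 1)) * g (x + y)) := by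
        refine lintegral_mono_ae ?_
        filter_upwards [Measure.ae_ne volume (0 : V)] with y hy
        rw [lintegral_mul_const' _ _ (by simp [hg]), ← mul_assoc]
        gcongr
        exact hlen y hy
    _ = 2 ^ d * 2 * ∫⁻ y, ‖x - y‖ₑ ^ (-(d - 1)) * g y := by
        rw [lintegral_const_mul' _ _ (by finiteness),
          ← lintegral_add_left_eq_self (fun y => ‖x - y‖ₑ ^ (-(d - 1)) * g y) x]
        simp

end GradientRepresentation

/-! ### From test functions to the completion. -/

section Completion

/-- The terms themselves are not assumed to lie in L^p. From some index K on, the differences g k -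
g K do; completeness is applied to these and g K is added back. -/
lemma exists_tendsto_eLpNorm_of_cauchy {X F : Type*} [MeasurableSpace X] {μ : Measure X}
    [NormedAddCommGroup F] [CompleteSpace F] {p : ℝ≥0∞} (hp : 1 ≤ p) {g : ℕ → X → F}
    (hg : ∀ k, AEStronglyMeasurable (g k) μ)
    (hc : Tendsto (fun jk : ℕ × ℕ => eLpNorm (g jk.1 - g jk.2) p μ) atTop (𝓝 0)) :
    ∃ f : X → F, AEStronglyMeasurable f μ ∧
      Tendsto (fun k => eLpNorm (g k - f) p μ) atTop (𝓝 0) := by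
  have : Fact (1 ≤ p) := ⟨hp⟩
  obtain ⟨⟨K₁, K₂⟩, hK⟩ := eventually_atTop.1 ((tendsto_order.1 hc).2 1 one_pos)
  set K := max K₁ K₂
  have hmem : ∀ k, MemLp (g (k + K) - g K) p μ := fun k =>
    ⟨(hg _).sub (hg _), (hK (k + K, K) ⟨(le_max_left K₁ K₂).trans (Nat.le_add_left _ _),
      le_max_right K₁ K₂⟩).trans ENNReal.one_lt_top⟩
  have hcauchy : CauchySeq fun k => (hmem k).toLp := by
    rw [Lp.cauchySeq_Lp_iff_cauchySeq_eLpNorm]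
    have hs : Tendsto (fun jk : ℕ × ℕ => (jk.1 + K, jk.2 + K)) atTop atTop := by
      rw [← prod_atTop_atTop_eq]
      exact (tendsto_add_atTop_nat K).prodMap (tendsto_add_atTop_nat K)
    refine (hc.comp hs).congr fun jk => ?_
    refine eLpNorm_congr_ae ?_
    filter_upwards [(hmem jk.1).coeFn_toLp, (hmem jk.2).coeFn_toLp] with x h₁ h₂
    simp [h₁, h₂]
  obtain ⟨G, hG⟩ := cauchySeq_tendsto_of_complete hcauchy
  rw [Lp.tendsto_Lp_iff_tendsto_eLpNorm'] at hG
  refine ⟨g K + G, (hg K).add (Lp.aestronglyMeasurable G), ?_⟩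
  rw [← tendsto_add_atTop_iff_nat K]
  refine hG.congr fun k => eLpNorm_congr_ae ?_
  filter_upwards [(hmem k).coeFn_toLp] with x h₁
  simp [h₁, sub_sub]

variable {n m : ℕ}

lemma ae_hat_ne_zero (hm : 0 < m) : ∀ᵐ X : Space n m, hat X ≠ 0 := by
  have : Nontrivial (EuclideanSpace ℝ (Fin m)) := by
    have : Nonempty (Fin m) := ⟨⟨0, hm⟩⟩
    infer_instance
  have h : ∀ᵐ z : EuclideanSpace ℝ (Fin n) × EuclideanSpace ℝ (Fin m), z.2 ≠ 0 :=
    Measure.quasiMeasurePreserving_snd.ae (Measure.ae_ne volume 0)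
  exact (measurePreserving_splitEquiv n m).quasiMeasurePreserving.ae h

lemma measurable_weight (a : ℝ) : Measurable (weight a : Space n m → ℝ) :=
  measurable_hat.norm.pow_const a

lemma weight_ne_zero {X : Space n m} (hX : hat X ≠ 0) (a : ℝ) : weight a X ≠ 0 :=
  (Real.rpow_pos_of_pos (norm_pos_iff.2 hX) a).ne'

lemma enorm_weight {X : Space n m} (hX : hat X ≠ 0) (a : ℝ) : ‖weight a X‖ₑ = ‖hat X‖ₑ ^ a := by
  rw [weight, Real.enorm_of_nonneg (by positivity),
    ← ENNReal.ofReal_rpow_of_pos (norm_pos_iff.2 hX), ofReal_norm]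

variable {F : Type*} [NormedAddCommGroup F] [NormedSpace ℝ F]

lemma eLpNorm_weight_smul (hm : 0 < m) {p : ℝ} (hp : 0 < p) (a : ℝ) (f : Space n m → F) :
    eLpNorm (fun X => weight a X • f X) (ENNReal.ofReal p) volume =
      lpn volume p fun X => ‖hat X‖ₑ ^ a * ‖f X‖ₑ := by
  rw [eLpNorm_eq_lintegral_rpow_enorm_toReal (by simpa using hp) ENNReal.ofReal_ne_top,
    ENNReal.toReal_ofReal hp.le]
  refine lpn_congr_ae ?_
  filter_upwards [ae_hat_ne_zero hm] with X hX
  rw [enorm_smul, enorm_weight hX]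

lemma eLpNorm_weight_smul_le (hm : 0 < m) {p q α β s : ℝ} (hp : 0 < p) (hq : 0 < q) {C₀ C : ℝ≥0∞}
    (hC₀ : C₀ ≠ ⊤) (hC : ∀ G : Space n m → ℝ≥0∞, Measurable G →
      lpn volume q (fun X => ‖hat X‖ₑ ^ (-β) * ∫⁻ Y, ‖X - Y‖ₑ ^ (-s) * G Y) ≤
        C * lpn volume p (fun Y => ‖hat Y‖ₑ ^ α * G Y))
    {φ : Space n m → ℝ} {f : Space n m → F} (hf : Continuous f)
    (h : ∀ X, ‖φ X‖ₑ ≤ C₀ * ∫⁻ Y, ‖X - Y‖ₑ ^ (-s) * ‖f Y‖ₑ) :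
    eLpNorm (fun X => weight (-β) X • φ X) (ENNReal.ofReal q) volume ≤
      C₀ * C * eLpNorm (fun X => weight α X • f X) (ENNReal.ofReal p) volume := by
  rw [eLpNorm_weight_smul hm hp, eLpNorm_weight_smul hm hq, mul_assoc]
  refine le_trans ?_ (mul_le_mul_right (hC _ hf.enorm.measurable) C₀)
  rw [← lpn_const_mul hq hC₀]
  refine lpn_mono hq fun X => ?_
  rw [mul_left_comm]
  exact mul_le_mul_right (h X) _

lemma aestronglyMeasurable_weight_smul (a : ℝ) {f : Space n m → F}
    (hf : AEStronglyMeasurable f volume) :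
    AEStronglyMeasurable (fun X => weight a X • f X) volume :=
  (measurable_weight a).aestronglyMeasurable.smul hf

lemma wdist_eq (a p : ℝ) (f g : Space n m → F) :
    wdist a p f g = eLpNorm ((fun X => weight a X • f X) - fun X => weight a X • g X)
      (ENNReal.ofReal p) volume := by
  rw [wdist]
  congr 1
  ext X
  simp [smul_sub]

/-- Multiplication by the weight leads to unweighted L^p, and the limit can be divided by the
weight, which vanishes only on a null set since m > 0. -/
lemma exists_tendsto_wdist_of_cauchy [CompleteSpace F] (hm : 0 < m) {a p : ℝ} (hp : 1 ≤ p)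
    {f : ℕ → Space n m → F} (hf : ∀ k, AEStronglyMeasurable (f k) volume)
    (hc : Tendsto (fun jk : ℕ × ℕ => wdist a p (f jk.1) (f jk.2)) atTop (𝓝 0)) :
    ∃ g : Space n m → F, AEStronglyMeasurable g volume ∧
      Tendsto (fun k => wdist a p (f k) g) atTop (𝓝 0) := by
  simp only [wdist_eq] at hc
  obtain ⟨G, hG, hlim⟩ := exists_tendsto_eLpNorm_of_cauchy
    (by rw [← ENNReal.ofReal_one]; exact ENNReal.ofReal_le_ofReal hp)
    (fun k => aestronglyMeasurable_weight_smul a (hf k)) hc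
  refine ⟨fun X => (weight a X)⁻¹ • G X,
    (measurable_weight a).inv.aestronglyMeasurable.smul hG, ?_⟩
  refine hlim.congr fun k => ?_
  rw [wdist_eq]
  refine eLpNorm_congr_ae ?_
  filter_upwards [ae_hat_ne_zero hm] with X hX
  simp [smul_inv_smul₀ (weight_ne_zero hX a)]

lemma exists_seq_tendsto_ae_of_wdist (hm : 0 < m) {a p : ℝ} (hp : 0 < p)
    {f : ℕ → Space n m → F} {g : Space n m → F} (hf : ∀ k, AEStronglyMeasurable (f k) volume)
    (hg : AEStronglyMeasurable g volume) (h : Tendsto (fun k => wdist a p (f k) g) atTop (𝓝 0)) :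
    ∃ ns : ℕ → ℕ, StrictMono ns ∧ ∀ᵐ X, Tendsto (fun k => f (ns k) X) atTop (𝓝 (g X)) := by
  simp only [wdist_eq] at h
  obtain ⟨ns, hns, hlim⟩ := (tendstoInMeasure_of_tendsto_eLpNorm (by simpa using hp)
    (fun k => aestronglyMeasurable_weight_smul a (hf k))
    (aestronglyMeasurable_weight_smul a hg) h).exists_seq_tendsto_ae
  refine ⟨ns, hns, ?_⟩
  filter_upwards [hlim, ae_hat_ne_zero hm] with X hX hX₀
  have := hX.const_smul (weight a X)⁻¹
  simpa only [inv_smul_smul₀ (weight_ne_zero hX₀ a)] using this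

variable {D : (Space n m → ℝ) → Space n m → F} {α β p q : ℝ} {C : ℝ≥0∞}

/-- Fatou's lemma on the left along the almost everywhere convergent sequence; the triangle
inequality on the right. -/
lemma InCompletion.eLpNorm_le (hp : 1 ≤ p) (hC : C ≠ ⊤)
    (hD : ∀ φ, IsTest φ → Continuous (D φ))
    (hle : ∀ φ, IsTest φ → eLpNorm (fun X => weight (-β) X • φ X) (ENNReal.ofReal q) volume ≤
      C * eLpNorm (fun X => weight α X • D φ X) (ENNReal.ofReal p) volume)
    {u : Space n m → ℝ} {f : Space n m → F} (h : InCompletion D α p u f) :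
    eLpNorm (fun X => weight (-β) X • u X) (ENNReal.ofReal q) volume ≤
      C * eLpNorm (fun X => weight α X • f X) (ENNReal.ofReal p) volume := by
  obtain ⟨hf, φ, hφ, hu, hlim⟩ := h
  have hp' : 1 ≤ ENNReal.ofReal p := by
    rw [← ENNReal.ofReal_one]; exact ENNReal.ofReal_le_ofReal hp
  set A := eLpNorm (fun X => weight α X • f X) (ENNReal.ofReal p) volume
  have hbound : ∀ k, eLpNorm (fun X => weight (-β) X • φ k X) (ENNReal.ofReal q) volume ≤
      C * (wdist α p (D (φ k)) f + A) := fun k => by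
    refine (hle _ (hφ k)).trans (mul_le_mul_right ?_ C)
    have hm₁ := aestronglyMeasurable_weight_smul α (hD _ (hφ k)).aestronglyMeasurable
    have hm₂ := aestronglyMeasurable_weight_smul α hf
    rw [wdist_eq]
    refine le_trans (le_of_eq ?_) (eLpNorm_add_le (hm₁.sub hm₂) hm₂ hp')
    rw [sub_add_cancel]
  have hC' : Tendsto (fun k => C * (wdist α p (D (φ k)) f + A)) atTop (𝓝 (C * A)) := by
    have := ENNReal.Tendsto.const_mul (hlim.add_const A) (Or.inr hC)
    rwa [zero_add] at this
  refine (Lp.eLpNorm_lim_le_liminf_eLpNorm (f := fun k X => weight (-β) X • φ k X) (fun k =>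
    aestronglyMeasurable_weight_smul (-β) (hφ k).1.continuous.aestronglyMeasurable) _ ?_).trans ?_
  · filter_upwards [hu] with X hX
    exact hX.const_smul _
  · rw [← hC'.liminf_eq]
    exact liminf_le_liminf (Eventually.of_forall hbound)

lemma IsTest.sub {φ ψ : Space n m → ℝ} (hφ : IsTest φ) (hψ : IsTest ψ) : IsTest (φ - ψ) :=
  ⟨hφ.1.sub hψ.1, hφ.2.sub hψ.2⟩

/-- The inequality for differences makes φ Cauchy in the weighted L^q, with limit u. A subsequence
converges almost everywhere and witnesses membership, while both norm limits hold for the whole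
sequence. -/
lemma IsCauchySeq.exists_inCompletion [CompleteSpace F] (hm : 0 < m) (hp : 1 ≤ p) (hq : 1 ≤ q)
    (hC : C ≠ ⊤) (hD : ∀ φ, IsTest φ → Continuous (D φ))
    (hsub : ∀ φ ψ, IsTest φ → IsTest ψ → D (φ - ψ) = D φ - D ψ)
    (hle : ∀ φ, IsTest φ → eLpNorm (fun X => weight (-β) X • φ X) (ENNReal.ofReal q) volume ≤
      C * eLpNorm (fun X => weight α X • D φ X) (ENNReal.ofReal p) volume)
    {φ : ℕ → Space n m → ℝ} (h : IsCauchySeq D α p φ) :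
    ∃ (u : Space n m → ℝ) (f : Space n m → F), InCompletion D α p u f ∧
      Tendsto (fun k => wdist α p (D (φ k)) f) atTop (𝓝 0) ∧
      Tendsto (fun k => wdist (-β) q (φ k) u) atTop (𝓝 0) := by
  obtain ⟨hφ, hc⟩ := h
  have hφm : ∀ k, AEStronglyMeasurable (φ k) volume := fun k =>
    (hφ k).1.continuous.aestronglyMeasurable
  have hDm : ∀ k, AEStronglyMeasurable (D (φ k)) volume := fun k =>
    (hD _ (hφ k)).aestronglyMeasurable
  have hc' : Tendsto (fun jk : ℕ × ℕ => wdist (-β) q (φ jk.1) (φ jk.2)) atTop (𝓝 0) := by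
    have hlim := ENNReal.Tendsto.const_mul hc (Or.inr hC)
    rw [mul_zero] at hlim
    refine tendsto_of_tendsto_of_tendsto_of_le_of_le tendsto_const_nhds hlim (fun _ => zero_le)
      fun jk => ?_
    have := hle _ ((hφ jk.1).sub (hφ jk.2))
    rwa [hsub _ _ (hφ _) (hφ _)] at this
  obtain ⟨f, hf, hflim⟩ := exists_tendsto_wdist_of_cauchy hm hp hDm hc
  obtain ⟨u, hu, hulim⟩ := exists_tendsto_wdist_of_cauchy hm hq hφm hc'
  obtain ⟨ns, hns, hae⟩ := exists_seq_tendsto_ae_of_wdist hm (by linarith) hφm hu hulim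
  exact ⟨u, f, ⟨hf, fun k => φ (ns k), fun k => hφ _, hae, hflim.comp hns.tendsto_atTop⟩,
    hflim, hulim⟩

/-- Both operators are treated together: all that matters about D is continuity of D φ,
compatibility with differences, and domination by the Riesz potential of degree n + m - γ. -/
theorem exists_sobolev_constant [CompleteSpace F] (hm : 0 < m) (hp : 1 < p) (hpq : p ≤ q)
    (hαβ : 0 ≤ α + β) (hα : α < (m : ℝ) / Real.conjExponent p) (hβ : β < (m : ℝ) / q)
    {γ : ℝ} (hγ : 0 < γ) (hγ' : γ < (n : ℝ) + m)
    (hdeg : 1 / q = 1 / p + (α + β - γ) / ((n : ℝ) + m))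
    (hD : ∀ φ, IsTest φ → Continuous (D φ))
    (hsub : ∀ φ ψ, IsTest φ → IsTest ψ → D (φ - ψ) = D φ - D ψ) (hC : C ≠ ⊤)
    (hpot : ∀ φ, IsTest φ → ∀ X,
      ‖φ X‖ₑ ≤ C * ∫⁻ Y, ‖X - Y‖ₑ ^ (-((n : ℝ) + m - γ)) * ‖D φ Y‖ₑ) :
    ∃ S : ℝ, 0 < S ∧
      (∀ (u : Space n m → ℝ) (f : Space n m → F), InCompletion D α p u f →
        eLpNorm (fun X => weight (-β) X * u X) (ENNReal.ofReal q) volume ≤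
          ENNReal.ofReal S * eLpNorm (fun X => weight α X • f X) (ENNReal.ofReal p) volume) ∧
      ∀ φ : ℕ → Space n m → ℝ, IsCauchySeq D α p φ →
        ∃ (u : Space n m → ℝ) (f : Space n m → F), InCompletion D α p u f ∧
          Tendsto (fun k => wdist α p (D (φ k)) f) atTop (𝓝 0) ∧
          Tendsto (fun k => wdist (-β) q (φ k) u) atTop (𝓝 0) := by
  obtain ⟨C', hC', hSW⟩ := exists_stein_weiss_partial hp hpq hm hαβ hα hβ hγ hγ' hdeg
  have hCC : C * C' ≠ ⊤ := ENNReal.mul_ne_top hC hC'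
  have hle : ∀ φ, IsTest φ → eLpNorm (fun X => weight (-β) X • φ X) (ENNReal.ofReal q) volume ≤
      C * C' * eLpNorm (fun X => weight α X • D φ X) (ENNReal.ofReal p) volume := fun φ hφ =>
    eLpNorm_weight_smul_le hm (by linarith) (by linarith) hC hSW (hD φ hφ) (hpot φ hφ)
  refine ⟨(C * C').toReal + 1, by positivity, fun u f h => ?_, fun φ h =>
    h.exists_inCompletion hm hp.le (hp.le.trans hpq) hCC hD hsub hle⟩
  refine (h.eLpNorm_le hp.le hCC hD hle).trans (mul_le_mul_left ?_ _)
  exact (ENNReal.ofReal_toReal hCC).ge.trans (ENNReal.ofReal_le_ofReal (by linarith))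

end Completion

/-! ### The fractional Laplacian and the gradient on test functions. -/

section Operators

variable {n m : ℕ}

lemma finrank_space (n m : ℕ) : (Module.finrank ℝ (Space n m) : ℝ) = (n : ℝ) + m := by
  rw [finrank_euclideanSpace, Fintype.card_sum, Fintype.card_fin, Fintype.card_fin, Nat.cast_add]

/-- A real test function as a complex-valued Schwartz function. -/
def IsTest.toSchwartz {φ : Space n m → ℝ} (hφ : IsTest φ) : SchwartzMap (Space n m) ℂ :=
  HasCompactSupport.toSchwartzMap (f := fun X => (φ X : ℂ))
    (hφ.2.comp_left Complex.ofReal_zero) (Complex.ofRealCLM.contDiff.comp hφ.1)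

lemma IsTest.toSchwartz_sub {φ ψ : Space n m → ℝ} (hφ : IsTest φ) (hψ : IsTest ψ) :
    (hφ.sub hψ).toSchwartz = hφ.toSchwartz - hψ.toSchwartz := by
  ext X
  exact Complex.ofReal_sub (φ X) (ψ X)

/-- The Fourier side of `(-Δ)^{γ/2}` on Schwartz functions. -/
def fracSymbol (γ : ℝ) (f : SchwartzMap (Space n m) ℂ) (ξ : Space n m) : ℂ :=
  (((2 * Real.pi * ‖ξ‖) ^ γ : ℝ) : ℂ) * 𝓕 f ξ

/-- The bound |ξ|^γ ≤ 1 + |ξ|^{⌈γ⌉} reduces to polynomial moments of a Schwartz function; the symbol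
itself need not be smooth at 0. -/
lemma integrable_fracSymbol {γ : ℝ} (hγ : 0 < γ) (f : SchwartzMap (Space n m) ℂ) :
    Integrable (fracSymbol γ f) := by
  have hcont : Continuous (fracSymbol γ f) := by
    refine Continuous.mul (Complex.continuous_ofReal.comp ?_) (𝓕 f).continuous
    exact (by fun_prop : Continuous fun ξ : Space n m => 2 * Real.pi * ‖ξ‖).rpow_const
      fun _ => Or.inr hγ.le
  have hdom : Integrable fun ξ : Space n m => (2 * Real.pi) ^ γ * (‖𝓕 f ξ‖ +
      ‖ξ‖ ^ ⌈γ⌉₊ * ‖𝓕 f ξ‖) :=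
    ((𝓕 f).integrable.norm.add ((𝓕 f).integrable_pow_mul volume _)).const_mul _
  refine hdom.mono' hcont.aestronglyMeasurable (Eventually.of_forall fun ξ => ?_)
  rw [fracSymbol, norm_mul, Complex.norm_real, Real.norm_of_nonneg (by positivity),
    Real.mul_rpow (by positivity) (norm_nonneg ξ), mul_assoc]
  refine mul_le_mul_of_nonneg_left ?_ (by positivity)
  rw [← one_add_mul]
  refine mul_le_mul_of_nonneg_right ?_ (norm_nonneg _)
  rcases le_total ‖ξ‖ 1 with h | h
  · exact (Real.rpow_le_one (norm_nonneg _) h hγ.le).trans (by simp)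
  · rw [← Real.rpow_natCast]
    exact (Real.rpow_le_rpow_of_exponent_le h (Nat.le_ceil γ)).trans (by simp)

lemma fracLaplacian_eq {φ : Space n m → ℝ} (hφ : IsTest φ) (γ : ℝ) :
    fracLaplacian γ φ = fun X => (𝓕⁻ (fracSymbol γ hφ.toSchwartz) X).re := rfl

lemma fourierInv_sub_apply {V : Type*} [NormedAddCommGroup V] [InnerProductSpace ℝ V]
    [FiniteDimensional ℝ V] [MeasurableSpace V] [BorelSpace V] {f g : V → ℂ} (hf : Integrable f)
    (hg : Integrable g) (x : V) : 𝓕⁻ (f - g) x = 𝓕⁻ f x - 𝓕⁻ g x := by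
  simp only [Real.fourierInv_eq_fourier_neg, Real.fourier_eq]
  rw [← integral_sub ((Real.fourierIntegral_convergent_iff _).2 hf)
    ((Real.fourierIntegral_convergent_iff _).2 hg)]
  simp [smul_sub]

lemma continuous_fracLaplacian {γ : ℝ} (hγ : 0 < γ) {φ : Space n m → ℝ} (hφ : IsTest φ) :
    Continuous (fracLaplacian γ φ) := by
  rw [fracLaplacian_eq hφ]
  exact Complex.continuous_re.comp (continuous_fourierInv (integrable_fracSymbol hγ _))

lemma fracLaplacian_sub {γ : ℝ} (hγ : 0 < γ) {φ ψ : Space n m → ℝ} (hφ : IsTest φ)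
    (hψ : IsTest ψ) :
    fracLaplacian γ (φ - ψ) = fracLaplacian γ φ - fracLaplacian γ ψ := by
  rw [fracLaplacian_eq (hφ.sub hψ), fracLaplacian_eq hφ, fracLaplacian_eq hψ]
  have h : fracSymbol γ (hφ.sub hψ).toSchwartz =
      fracSymbol γ hφ.toSchwartz - fracSymbol γ hψ.toSchwartz := by
    ext ξ
    have hF : 𝓕 (hφ.toSchwartz - hψ.toSchwartz) = 𝓕 hφ.toSchwartz - 𝓕 hψ.toSchwartz :=
      (SchwartzMap.fourierTransformCLM ℂ).map_sub _ _
    simp only [fracSymbol, hφ.toSchwartz_sub hψ, hF, Pi.sub_apply, sub_apply, mul_sub]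
  ext X
  rw [h, fourierInv_sub_apply (integrable_fracSymbol hγ _) (integrable_fracSymbol hγ _)]
  simp

/-- Fourier inversion with ψ the transform of φ; as φ is real, taking the real part of 𝓕⁻ ψ loses
nothing. -/
lemma exists_enorm_le_riesz_potential_fracLaplacian {γ : ℝ} (hγ : 0 < γ)
    (hγ' : γ < (n : ℝ) + m) : ∃ C : ℝ≥0∞, C ≠ ⊤ ∧ ∀ φ : Space n m → ℝ, IsTest φ → ∀ X,
      ‖φ X‖ₑ ≤ C * ∫⁻ Y, ‖X - Y‖ₑ ^ (-((n : ℝ) + m - γ)) * ‖fracLaplacian γ φ Y‖ₑ := by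
  obtain ⟨C, hC, h⟩ := exists_enorm_le_riesz_potential (V := Space n m) hγ
    (by rwa [finrank_space])
  refine ⟨C, hC, fun φ hφ X => ?_⟩
  have hinv : 𝓕⁻ (𝓕 hφ.toSchwartz : SchwartzMap (Space n m) ℂ) X = (φ X : ℂ) := by
    rw [FourierTransform.fourierInv_fourier_eq]; rfl
  set ψ : SchwartzMap (Space n m) ℂ := 𝓕 hφ.toSchwartz
  have := h ψ (fracSymbol γ hφ.toSchwartz) ψ.continuous ψ.integrable (integrable_fracSymbol hγ _) (fun ξ => rfl) X
  rw [← SchwartzMap.fourierInv_coe, hinv, Complex.ofReal_re, finrank_space] at this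
  exact this

lemma enorm_gradient {V : Type*} [NormedAddCommGroup V] [InnerProductSpace ℝ V] [CompleteSpace V]
    (φ : V → ℝ) (X : V) : ‖gradient φ X‖ₑ = ‖fderiv ℝ φ X‖ₑ := by
  rw [gradient, LinearIsometryEquiv.enorm_map]

lemma continuous_gradient {φ : Space n m → ℝ} (hφ : IsTest φ) : Continuous (gradient φ) :=
  (InnerProductSpace.toDual ℝ _).symm.continuous.comp (hφ.1.continuous_fderiv (by simp))

lemma gradient_sub {φ ψ : Space n m → ℝ} (hφ : IsTest φ) (hψ : IsTest ψ) :
    gradient (φ - ψ) = gradient φ - gradient ψ := by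
  ext1 X
  simp only [gradient, Pi.sub_apply]
  rw [fderiv_sub ((hφ.1.differentiable (by simp)) X) ((hψ.1.differentiable (by simp)) X), map_sub]

lemma exists_enorm_le_riesz_potential_gradient (hm : 0 < m) :
    ∃ C : ℝ≥0∞, C ≠ ⊤ ∧ ∀ φ : Space n m → ℝ, IsTest φ → ∀ X,
      ‖φ X‖ₑ ≤ C * ∫⁻ Y, ‖X - Y‖ₑ ^ (-((n : ℝ) + m - 1)) * ‖gradient φ Y‖ₑ := by
  have : Nonempty (Fin m) := ⟨⟨0, hm⟩⟩
  have : Nontrivial (Space n m) := inferInstance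
  obtain ⟨C, hC, h⟩ := exists_enorm_le_riesz_potential_fderiv (V := Space n m)
  refine ⟨C, hC, fun φ hφ X => ?_⟩
  have := h φ (hφ.1.of_le (by simp)) hφ.2 X
  simpa only [enorm_gradient, finrank_space] using this

end Operators

/-! ### What the exponents force on the dimensions, and the theorem. -/

/-- For m = 0 the bounds would read α < 0 and β < 0, against α + β ≥ 0. -/
lemma pos_of_lt_div {m : ℕ} {p q α β : ℝ} (hαβ : 0 ≤ α + β)
    (hα : α < (m : ℝ) / Real.conjExponent p) (hβ : β < (m : ℝ) / q) : 0 < m := by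
  rcases Nat.eq_zero_or_pos m with rfl | h
  · simp only [Nat.cast_zero, zero_div] at hα hβ
    linarith
  · exact h

/-- Otherwise n = 0 and m = 1, and scaling gives α + β = 1/p' + 1/q, the sum of two strict upper
bounds. Thus γ = 1 meets the requirement γ < n + m. -/
lemma one_lt_add_of_scaling {n m : ℕ} {p q α β : ℝ} (hp : 1 < p)
    (hαβ : 0 ≤ α + β) (hα : α < (m : ℝ) / Real.conjExponent p) (hβ : β < (m : ℝ) / q)
    (hdeg : 1 / q = 1 / p + (α + β - 1) / ((n : ℝ) + m)) : (1 : ℝ) < (n : ℝ) + m := by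
  have hm := pos_of_lt_div hαβ hα hβ
  by_contra! hle
  have hnm : n + m ≤ 1 := by exact_mod_cast hle
  obtain rfl : n = 0 := by omega
  obtain rfl : m = 1 := by omega
  have hconj : 1 / Real.conjExponent p = 1 - 1 / p := by
    have := (Real.HolderConjugate.conjExponent hp).one_sub_inv
    simp only [one_div, this]
  simp only [Nat.cast_zero, Nat.cast_one, zero_add, div_one] at hα hβ hdeg
  linarith

end PartialWeight

end

theorem theorem1p12 (n m : ℕ) (p q α β : ℝ) (hp : 1 < p) (hpq : p ≤ q) (hαβ : 0 ≤ α + β)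
    (hα : α < (m : ℝ) / Real.conjExponent p) (hβ : β < (m : ℝ) / q) :
    (∀ γ : ℝ, 0 < γ → γ < (n : ℝ) + m → 1 / q = 1 / p + (α + β - γ) / ((n : ℝ) + m) →
      ∃ S : ℝ, 0 < S ∧
        (∀ u f : PartialWeight.Space n m → ℝ, PartialWeight.InFracSobolev γ α p u f →
          eLpNorm (fun X => PartialWeight.weight (-β) X * u X) (ENNReal.ofReal q) volume ≤
            ENNReal.ofReal S *
              eLpNorm (fun X => PartialWeight.weight α X * f X) (ENNReal.ofReal p) volume) ∧
        (∀ φ : ℕ → PartialWeight.Space n m → ℝ,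
          PartialWeight.IsCauchySeq (PartialWeight.fracLaplacian γ) α p φ →
          ∃ u f : PartialWeight.Space n m → ℝ, PartialWeight.InFracSobolev γ α p u f ∧
            Tendsto (fun k => PartialWeight.wdist α p (PartialWeight.fracLaplacian γ (φ k)) f)
              atTop (𝓝 0) ∧
            Tendsto (fun k => PartialWeight.wdist (-β) q (φ k) u) atTop (𝓝 0))) ∧
    (1 / q = 1 / p + (α + β - 1) / ((n : ℝ) + m) →
      ∃ S : ℝ, 0 < S ∧
        (∀ (u : PartialWeight.Space n m → ℝ)
            (G : PartialWeight.Space n m → PartialWeight.Space n m),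
          PartialWeight.InGradSobolev α p u G →
          eLpNorm (fun X => PartialWeight.weight (-β) X * u X) (ENNReal.ofReal q) volume ≤
            ENNReal.ofReal S *
              eLpNorm (fun X => PartialWeight.weight α X • G X) (ENNReal.ofReal p) volume) ∧
        (∀ φ : ℕ → PartialWeight.Space n m → ℝ,
          PartialWeight.IsCauchySeq gradient α p φ →
          ∃ (u : PartialWeight.Space n m → ℝ)
            (G : PartialWeight.Space n m → PartialWeight.Space n m),
            PartialWeight.InGradSobolev α p u G ∧
            Tendsto (fun k => PartialWeight.wdist α p (gradient (φ k)) G) atTop (𝓝 0) ∧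
            Tendsto (fun k => PartialWeight.wdist (-β) q (φ k) u) atTop (𝓝 0))) := by
  have hm := PartialWeight.pos_of_lt_div hαβ hα hβ
  refine ⟨fun γ hγ hγ' hdeg => ?_, fun hdeg => ?_⟩
  · obtain ⟨C, hC, h⟩ :=
      PartialWeight.exists_enorm_le_riesz_potential_fracLaplacian (n := n) (m := m) hγ hγ'
    exact PartialWeight.exists_sobolev_constant hm hp hpq hαβ hα hβ hγ hγ' hdeg
      (fun φ hφ => PartialWeight.continuous_fracLaplacian hγ hφ)
      (fun φ ψ hφ hψ => PartialWeight.fracLaplacian_sub hγ hφ hψ) hC h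
  · obtain ⟨C, hC, h⟩ := PartialWeight.exists_enorm_le_riesz_potential_gradient (n := n) hm
    exact PartialWeight.exists_sobolev_constant hm hp hpq hαβ hα hβ one_pos
      (PartialWeight.one_lt_add_of_scaling hp hαβ hα hβ hdeg) hdeg
      (fun φ hφ => PartialWeight.continuous_gradient hφ)
      (fun φ ψ hφ hψ => PartialWeight.gradient_sub hφ hψ) hC h
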